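/- **Kelvin–Noether circulation theorem.** Let $\mathcal D$ be a smooth $n$-dimensional manifold (Hausdorff, second countable, possibly with boundary or corners) with a smooth positive density $dV$; write $\operatorname{div}$ for the divergence with respect to $dV$, that is, $\pounds_w dV=(\operatorname{div}w)\,dV$. Let $\mathfrak g$ be a vector space of $C^1$ vector fields on $\mathcal D$ that contains all smooth vector fields with compact support in the interior of $\mathcal D$. Let $V^*$ be a vector space of finite families $a=(a_i)$ of $C^1$ tensor fields or tensor field densities on $\mathcal D$ of prescribed types, and let $\ell:\mathfrak g\times V^*\to\mathbb R$ be a function (the reduced Lagrangian). The variational derivatives are the one-form density $\frac{\delta\ell}{\delta u}=m\otimes dV$ and the continuous dual tensor field (density) $\frac{\delta\ell}{\delta a}$ that satisfy $$\frac{d}{d\varepsilon}\Big|_{0}\ell(u+\varepsilon w,a)=\int_{\mathcal D} m\cdot w\,dV,\qquad \frac{d}{d\varepsilon}\Big|_{0}\ell(u,a+\varepsilon c)=\int_{\mathcal D}\frac{\delta\ell}{\delta a}\cdot c$$ for all $w\in\mathfrak g$ and $c\in V^*$ with compact support in the interior of $\mathcal D$. For a dual tensor field $b$, the continuous one-form density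 $b\diamond a$ is defined by $$\langle b\diamond a,w\rangle=-\int_{\mathcal D} b\cdot\pounds_w a\qquad\text{for all such } w .$$ Let $J\subseteq\mathbb R$ be an open interval, let $\eta_t$ $(t\in J)$ be a path of $C^2$ diffeomorphisms of $\mathcal D$, jointly $C^2$ in time and space, and let $u_t\in\mathfrak g$ be its Eulerian velocity, $u_t=\frac{d\eta_t}{dt}\circ\eta_t^{-1}$, jointly $C^1$ in time and space. Suppose that $a_t\in V^*$ satisfies the advection relation $$\frac{\partial a}{\partial t}+\pounds_u a=0,$$ that $\frac{\delta\ell}{\delta u}$, $\frac{\delta\ell}{\delta a}$ (at $(u_t,a_t)$) and $\frac{\delta\ell}{\delta a}\diamond a$ exist for all $t\in J$, that $\frac{\delta\ell}{\delta u}$ is jointly $C^1$ in time and space, and that the Euler–Poincaré equation for continua holds on $J\times\mathcal D$: $$\frac{\partial}{\partial t}\frac{\delta\ell}{\delta u}=-\pounds_u\frac{\delta\ell}{\delta u}+\frac{\delta\ell}{\delta a}\diamond a .$$ Let $D:J\times\mathcal D\to\mathbb R$ be $C^1$ and nowhere zero (the mass density being $D_t\,dV$). Dividing a one-form density $\alpha\otimes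 dV$ by the density $D\,dV$ gives the one-form $\frac1D\alpha$. Then: 1. If $D_t\,dV=(\eta_t)_*(D_0\,dV)$ for all $t\in J$, for some reference density $D_0\,dV$, then $D$ satisfies the continuity equation $\partial_t D+\operatorname{div}(Du)=0$. 2. If $D$ satisfies the continuity equation, then for every $C^1$ loop $\gamma_0:\mathbb R/\mathbb Z\to\mathcal D$, with $\gamma_t=\eta_t\circ\gamma_0$, the circulation $I(t)=\oint_{\gamma_t}\frac1D\frac{\delta\ell}{\delta u}$ is differentiable on $J$ and $$\frac{dI}{dt}=\oint_{\gamma_t}\frac1D\,\frac{\delta\ell}{\delta a}\diamond a .$$ -/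

import Mathlib

open scoped Manifold ContDiff

namespace KelvinNoether

noncomputable section

/-! ### Tensors on the model space -/

/-- The tensors of type `(r, s)` over `ℝⁿ`, given by their components `T^{i₁…i_r}_{j₁…j_s}`. -/
abbrev Tens (n r s : ℕ) : Type :=
  (Fin r → Fin n) → (Fin s → Fin n) → ℝ

/-- The entry `A^i_k` of the matrix of a linear map. -/
def entry {n : ℕ} (A : EuclideanSpace ℝ (Fin n) →L[ℝ] EuclideanSpace ℝ (Fin n)) (i k : Fin n) : ℝ :=
  A (EuclideanSpace.single k 1) i

/-- The transformation law of tensors, `T^{k…}_{l…} ↦ G^{i₁}_{k₁} ⋯ H^{l₁}_{j₁} ⋯ T^{k…}_{l…}`.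
If `H` is invertible and `G = H⁻¹`, this is the pullback of `T` by `H`. -/
def tensMap {n : ℕ} (r s : ℕ) (G H : EuclideanSpace ℝ (Fin n) →L[ℝ] EuclideanSpace ℝ (Fin n))
    (T : Tens n r s) : Tens n r s :=
  fun i j => ∑ k : Fin r → Fin n, ∑ l : Fin s → Fin n,
    (∏ p, entry G (i p) (k p)) * (∏ q, entry H (l q) (j q)) * T k l

/-- The contraction of a tensor of type `(s, r)` with a tensor of type `(r, s)`. -/
def contract {n r s : ℕ} (b : Tens n s r) (a : Tens n r s) : ℝ :=
  ∑ i : Fin r → Fin n, ∑ j : Fin s → Fin n, b j i * a i j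

/-- The infinitesimal pullback action of a linear map `A` on tensors, that is, the derivative at
`ε = 0` of the pullback by `1 + ε A` (whose inverse is `1 - ε A` up to `O(ε²)`). -/
def tensDeriv {n : ℕ} (r s : ℕ) (A : EuclideanSpace ℝ (Fin n) →L[ℝ] EuclideanSpace ℝ (Fin n))
    (T : Tens n r s) : Tens n r s :=
  deriv (fun ε : ℝ => tensMap r s (1 - ε • A) (1 + ε • A) T) 0

/-- The type of an advected tensor: the numbers of contravariant and covariant slots, and whether
it is a tensor density `T ⊗ dV` or a plain tensor `T`. -/
structure TensorType where
  contra : ℕ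
  cov : ℕ
  isDensity : Bool

section Manifold

variable {n : ℕ} {H : Type*} [TopologicalSpace H]
  (I : ModelWithCorners ℝ (EuclideanSpace ℝ (Fin n)) H)
  {M : Type*} [TopologicalSpace M] [ChartedSpace H M]

/-! ### Components in charts

A tangent vector at `y` is a vector of `EuclideanSpace ℝ (Fin n)` through the preferred chart
at `y`. Fields are differentiated at `x` after pulling them back by the inverse of the preferred
chart at `x`. -/

/-- The differential at `e` of the inverse of the preferred chart at `x`. -/
def chartDeriv (x : M) (e : EuclideanSpace ℝ (Fin n)) :
    EuclideanSpace ℝ (Fin n) →L[ℝ] EuclideanSpace ℝ (Fin n) :=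
  mfderivWithin 𝓘(ℝ, EuclideanSpace ℝ (Fin n)) I (extChartAt I x).symm (Set.range I) e

/-- The components of a vector field in the preferred chart at `x`. -/
def vecRep (x : M) (w : (y : M) → TangentSpace I y) (e : EuclideanSpace ℝ (Fin n)) :
    EuclideanSpace ℝ (Fin n) :=
  (chartDeriv I x e).inverse (w ((extChartAt I x).symm e))

/-- The components of a one-form in the preferred chart at `x`. -/
def formRep (x : M) (m : (y : M) → TangentSpace I y →L[ℝ] ℝ) (e : EuclideanSpace ℝ (Fin n)) :
    EuclideanSpace ℝ (Fin n) →L[ℝ] ℝ :=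
  ContinuousLinearMap.comp (m ((extChartAt I x).symm e)) (chartDeriv I x e)

/-- The components of a tensor field of type `(r, s)` in the preferred chart at `x`. -/
def tensRep {r s : ℕ} (x : M) (T : M → Tens n r s) (e : EuclideanSpace ℝ (Fin n)) : Tens n r s :=
  tensMap r s (chartDeriv I x e).inverse (chartDeriv I x e) (T ((extChartAt I x).symm e))

/-- The coefficient in the preferred chart at `x` of a density whose coefficient at each `y` in
the preferred chart at `y` is `ρ y`. -/
def densRep (x : M) (ρ : M → ℝ) (e : EuclideanSpace ℝ (Fin n)) : ℝ :=
  ρ ((extChartAt I x).symm e) * |(chartDeriv I x e).det|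

/-! ### The volume density `dV` -/

variable (M) in
/-- A smooth positive density `dV` on `M`, with the measure that it defines. -/
structure VolumeDensity [MeasurableSpace M] where
  /-- the coefficient of `dV` at `x` in the preferred chart at `x` -/
  coeff : M → ℝ
  coeff_pos : ∀ x, 0 < coeff x
  smooth : ∀ x, ContDiffOn ℝ ∞ (densRep I x coeff) (extChartAt I x).target
  /-- the measure `dV` -/
  measure : MeasureTheory.Measure M
  measure_eq : ∀ (x : M) (A : Set M), MeasurableSet A → A ⊆ (extChartAt I x).source →
    measure A = ∫⁻ e in extChartAt I x '' A, ENNReal.ofReal (densRep I x coeff e)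

variable {I}
variable [MeasurableSpace M]

/-- The divergence `div_{dV} w`, defined by `£_w dV = (div_{dV} w) dV`; in coordinates it is
`ρ⁻¹ ∂_j (ρ w^j)`, with `dV = ρ dx`. -/
def divergence (dV : VolumeDensity I M) (w : (y : M) → TangentSpace I y) (x : M) : ℝ :=
  (dV.coeff x)⁻¹ *
      (fderivWithin ℝ (densRep I x dV.coeff) (Set.range I) (extChartAt I x x) (w x)) +
    LinearMap.trace ℝ (EuclideanSpace ℝ (Fin n))
      (fderivWithin ℝ (vecRep I x w) (Set.range I) (extChartAt I x x)).toLinearMap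

/-- The Jacobian of a map relative to `dV`: `φ^* dV = (jacobian dV φ) dV`. -/
def jacobian (dV : VolumeDensity I M) (φ : M → M) (x : M) : ℝ :=
  dV.coeff (φ x) * |ContinuousLinearMap.det
    (show EuclideanSpace ℝ (Fin n) →L[ℝ] EuclideanSpace ℝ (Fin n) from mfderiv I I φ x)| /
    dV.coeff x

/-! ### Lie derivatives -/

/-- The Lie derivative of a one-form; in coordinates, `u^j ∂_j m_i + m_j ∂_i u^j`. -/
def lieForm (u : (y : M) → TangentSpace I y) (m : (y : M) → TangentSpace I y →L[ℝ] ℝ) (x : M) :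
    TangentSpace I x →L[ℝ] ℝ :=
  (show EuclideanSpace ℝ (Fin n) →L[ℝ] ℝ from
    fderivWithin ℝ (formRep I x m) (Set.range I) (extChartAt I x x) (u x) +
      ContinuousLinearMap.comp (m x)
        (fderivWithin ℝ (vecRep I x u) (Set.range I) (extChartAt I x x)))

/-- The Lie derivative of a one-form density `m ⊗ dV`, again relative to `dV`:
`£_u (m ⊗ dV) = (£_u m + (div_{dV} u) m) ⊗ dV`. -/
def lieFormDensity (dV : VolumeDensity I M) (u : (y : M) → TangentSpace I y)
    (m : (y : M) → TangentSpace I y →L[ℝ] ℝ) (x : M) : TangentSpace I x →L[ℝ] ℝ :=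
  lieForm u m x + divergence dV u x • m x

/-- The Lie derivative of a density `f dV`, relative to `dV`:
`£_u (f dV) = (u · f + f div_{dV} u) dV = (div_{dV} (f u)) dV`. -/
def lieDensity (dV : VolumeDensity I M) (u : (y : M) → TangentSpace I y) (f : M → ℝ) (x : M) : ℝ :=
  (show ℝ from mfderiv I 𝓘(ℝ, ℝ) f x (u x)) + f x * divergence dV u x

/-- The Lie derivative of a tensor field of type `(r, s)`. -/
def lieTens {r s : ℕ} (u : (y : M) → TangentSpace I y) (T : M → Tens n r s) (x : M) :
    Tens n r s :=
  fderivWithin ℝ (tensRep I x T) (Set.range I) (extChartAt I x x) (u x) +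
    tensDeriv r s (fderivWithin ℝ (vecRep I x u) (Set.range I) (extChartAt I x x)) (T x)

/-! ### Families of tensor fields and tensor densities -/

section Fields

variable {ι : Type*} (τ : ι → TensorType)

variable (n M) in
/-- Families of tensor fields of the prescribed types; the field of index `i` stands for the
tensor density `a i ⊗ dV` if `τ i` is a density type, and for the tensor `a i` itself otherwise. -/
abbrev TensorFields : Type _ :=
  (i : ι) → M → Tens n (τ i).contra (τ i).cov

variable (n M) in
/-- Families of fields of dual tensors, of types `(s, r)` instead of `(r, s)`; the pairing of `b` with `a` is the integral
of `∑ i, b i · a i` against `dV`. Thus `b i` stands for `b i ⊗ dV` if `τ i` is not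
a density type. -/
abbrev DualFields : Type _ :=
  (i : ι) → M → Tens n (τ i).cov (τ i).contra

variable {τ}

variable (I) in
/-- `C¹` families of tensor fields. -/
def IsC1Tensor (a : TensorFields n M τ) : Prop :=
  ∀ i x, ContDiffOn ℝ 1 (tensRep I x (a i)) (extChartAt I x).target

variable (I) in
/-- Continuous families of dual tensor fields. -/
def IsContinuousDual (b : DualFields n M τ) : Prop :=
  ∀ i x, ContinuousOn (tensRep I x (b i)) (extChartAt I x).target

/-- The Lie derivative of a family of tensor fields and tensor densities, with
`£_u (T ⊗ dV) = (£_u T + (div_{dV} u) T) ⊗ dV` for the members that are densities. -/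
def lieFields (dV : VolumeDensity I M) (u : (y : M) → TangentSpace I y)
    (a : TensorFields n M τ) : TensorFields n M τ :=
  fun i x => lieTens u (a i) x + (if (τ i).isDensity then divergence dV u x else 0) • a i x

/-- The pairing of dual tensor fields with tensor fields. -/
def pairFields [Fintype ι] (dV : VolumeDensity I M) (b : DualFields n M τ)
    (a : TensorFields n M τ) : ℝ :=
  ∫ x, ∑ i, contract (b i x) (a i x) ∂dV.measure

end Fields

/-- The pairing of the one-form density `m ⊗ dV` with a vector field. -/
def pairForm (dV : VolumeDensity I M) (m : (y : M) → TangentSpace I y →L[ℝ] ℝ)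
    (w : (y : M) → TangentSpace I y) : ℝ :=
  ∫ x, m x (w x) ∂dV.measure

variable [IsManifold I ∞ M]

variable (I M) in
/-- The `C¹` vector fields on `M`. -/
abbrev VectorFields : Type _ :=
  Cₛ^1⟮I; EuclideanSpace ℝ (Fin n), (TangentSpace I : M → Type _)⟯

variable (I) in
/-- The field `f` vanishes outside a compact subset of the interior of `M`. -/
def CompactlySupportedInside {F : M → Type*} [∀ x, Zero (F x)] (f : (x : M) → F x) : Prop :=
  ∃ K : Set M, IsCompact K ∧ K ⊆ I.interior M ∧ ∀ x ∉ K, f x = 0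

/-- `𝔤` contains all smooth vector fields with compact support in the interior of `M`. -/
def ContainsTestFields (𝔤 : Submodule ℝ (VectorFields I M)) : Prop :=
  ∀ w : VectorFields I M,
    ContMDiff I I.tangent ∞ (fun x => (⟨x, w x⟩ : TangentBundle I M)) →
    CompactlySupportedInside I (fun x => w x) → w ∈ 𝔤

/-! ### Variational derivatives and the diamond operation -/

section Lagrangian

variable {ι : Type*} [Fintype ι] {τ : ι → TensorType}
  (dV : VolumeDensity I M) {𝔤 : Submodule ℝ (VectorFields I M)}
  {Vstar : Submodule ℝ (TensorFields n M τ)} (ℓ : 𝔤 → Vstar → ℝ)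

/-- `δℓ/δu (u, a) = m ⊗ dV`. -/
def IsVelocityDerivative (u : 𝔤) (a : Vstar) (m : (y : M) → TangentSpace I y →L[ℝ] ℝ) : Prop :=
  ∀ w : 𝔤, CompactlySupportedInside I (fun x => w.1 x) →
    HasDerivAt (fun ε : ℝ => ℓ (u + ε • w) a) (pairForm dV m (fun x => w.1 x)) 0

/-- `δℓ/δa (u, a) = b`. -/
def IsTensorDerivative (u : 𝔤) (a : Vstar) (b : DualFields n M τ) : Prop :=
  IsContinuousDual I b ∧
  ∀ c : Vstar, (∀ i, CompactlySupportedInside I (c.1 i)) →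
    HasDerivAt (fun ε : ℝ => ℓ u (a + ε • c)) (pairFields dV b c.1) 0

variable (𝔤) in
/-- `b ⋄ a = F ⊗ dV`, that is, `⟨F ⊗ dV, w⟩ = - ∫ b · £_w a` for all compactly supported `w`. -/
def IsDiamond (b : DualFields n M τ) (a : TensorFields n M τ)
    (F : (y : M) → TangentSpace I y →L[ℝ] ℝ) : Prop :=
  ContMDiff I (I.prod 𝓘(ℝ, EuclideanSpace ℝ (Fin n) →L[ℝ] ℝ)) 0
    (fun x => Bundle.TotalSpace.mk' (EuclideanSpace ℝ (Fin n) →L[ℝ] ℝ)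
      (E := fun y : M => TangentSpace I y →L[ℝ] ℝ) x (F x)) ∧
  ∀ w : 𝔤, CompactlySupportedInside I (fun x => w.1 x) →
    pairForm dV F (fun x => w.1 x) = - pairFields dV b (lieFields dV (fun x => w.1 x) a)

end Lagrangian

/-! ### Time-dependent fields, flows and loops

`J` is the time interval. -/

/-- The time-dependent vector field `u` is jointly `C¹`. -/
def JointlyC1Vector (J : Set ℝ) (u : ℝ → (y : M) → TangentSpace I y) : Prop :=
  ContMDiffOn (𝓘(ℝ, ℝ).prod I) I.tangent 1
    (fun p : ℝ × M => (⟨p.2, u p.1 p.2⟩ : TangentBundle I M)) (J ×ˢ Set.univ)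

/-- The time-dependent one-form `m` is jointly `C¹`. -/
def JointlyC1Form (J : Set ℝ) (m : ℝ → (y : M) → TangentSpace I y →L[ℝ] ℝ) : Prop :=
  ContMDiffOn (𝓘(ℝ, ℝ).prod I) (I.prod 𝓘(ℝ, EuclideanSpace ℝ (Fin n) →L[ℝ] ℝ)) 1
    (fun p : ℝ × M => Bundle.TotalSpace.mk' (EuclideanSpace ℝ (Fin n) →L[ℝ] ℝ)
      (E := fun y : M => TangentSpace I y →L[ℝ] ℝ) p.2 (m p.1 p.2)) (J ×ˢ Set.univ)

/-- `η` is a jointly `C²` path of diffeomorphisms with Eulerian velocity `u`, that is,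
`dη_t/dt = u_t ∘ η_t`. -/
def IsFlowOf (J : Set ℝ) (η : ℝ → M ≃ₘ^2⟮I, I⟯ M) (u : ℝ → (y : M) → TangentSpace I y) : Prop :=
  ContMDiffOn (𝓘(ℝ, ℝ).prod I) I 2 (fun p : ℝ × M => η p.1 p.2) (J ×ˢ Set.univ) ∧
  ∀ t ∈ J, ∀ X : M, HasMFDerivAt 𝓘(ℝ, ℝ) I (fun σ => η σ X) t
    (ContinuousLinearMap.toSpanSingleton ℝ (u t (η t X)))

/-- The Euler-Poincaré equation `∂ₜ (m ⊗ dV) = - £_u (m ⊗ dV) + F ⊗ dV`. -/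
def EulerPoincareEquation (J : Set ℝ) (dV : VolumeDensity I M)
    (u : ℝ → (y : M) → TangentSpace I y) (m F : ℝ → (y : M) → TangentSpace I y →L[ℝ] ℝ) : Prop :=
  ∀ t ∈ J, ∀ (x : M) (v : TangentSpace I x),
    HasDerivAt (fun σ => m σ x v) (- lieFormDensity dV (u t) (m t) x v + F t x v) t

/-- The advection relation `∂ₜ a + £_u a = 0`. -/
def AdvectionRelation {ι : Type*} {τ : ι → TensorType} (J : Set ℝ) (dV : VolumeDensity I M)
    (u : ℝ → (y : M) → TangentSpace I y) (a : ℝ → TensorFields n M τ) : Prop :=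
  ∀ t ∈ J, ∀ i x, HasDerivAt (fun σ => a σ i x) (- lieFields dV (u t) (a t) i x) t

/-- The continuity equation `∂ₜ D + div_{dV} (D u) = 0` for the density `D dV`. -/
def ContinuityEquation (J : Set ℝ) (dV : VolumeDensity I M)
    (u : ℝ → (y : M) → TangentSpace I y) (D : ℝ → M → ℝ) : Prop :=
  ∀ t ∈ J, ∀ x, HasDerivAt (fun σ => D σ x) (- lieDensity dV (u t) (D t) x) t

/-- The relation `D_t dV = (η_t)_* (D₀ dV)`, written as `η_t^* (D_t dV) = D₀ dV`. -/
def PushForwardRelation (J : Set ℝ) (dV : VolumeDensity I M) (η : ℝ → M ≃ₘ^2⟮I, I⟯ M)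
    (D : ℝ → M → ℝ) (D₀ : M → ℝ) : Prop :=
  ∀ t ∈ J, ∀ X, D t (η t X) * jacobian dV (η t) X = D₀ X

/-- The integral of a one-form along the loop `γ`, parametrized by `[0, 1]`. -/
def loopIntegral (α : (y : M) → TangentSpace I y →L[ℝ] ℝ) (γ : ℝ → M) : ℝ :=
  ∫ s in (0 : ℝ)..1, α (γ s) (mfderiv 𝓘(ℝ, ℝ) I γ s (1 : ℝ))

variable (I) in
/-- `γ` is a `C¹` loop, that is, a `C¹` map on `ℝ / ℤ`. -/
def IsLoop (γ : ℝ → M) : Prop :=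
  ContMDiff 𝓘(ℝ, ℝ) I 1 γ ∧ Function.Periodic γ 1

/-- The one-form `D⁻¹ m` obtained by dividing `m ⊗ dV` by `D dV`. -/
def divDensity (D : M → ℝ) (m : (y : M) → TangentSpace I y →L[ℝ] ℝ) (x : M) :
    TangentSpace I x →L[ℝ] ℝ :=
  (D x)⁻¹ • m x

end Manifold

end

end KelvinNoether

open KelvinNoether

/-!
The circulation of a time-dependent one-form `α` along a moving loop is pulled back to the fixed
initial loop, where the classical formula `∂ₜ (φ_t^* α) = φ_t^* (∂ₜ α + £_u α)` can be integrated.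
Since `∂ₜ α + £_u α = β` gives `d/dt ∮ α = ∮ β` (`hasDerivAt_loopIntegral_of_flow`), the circulation
theorem reduces to `∂ₜ α + £_u α = D⁻¹ F` for `α = D⁻¹ m`. The Euler-Poincaré equation says that
`∂ₜ m + £_u m = F - (div u) m`, and the continuity equation says that `D⁻¹` satisfies
`∂ₜ D⁻¹ + u · D⁻¹ = (div u) D⁻¹`, so the divergence terms cancel
(`ContinuityEquation.hasDerivAt_divDensity`).

Near a fixed time and a fixed point, everything is read in the preferred charts at the point and at
its image. The flow becomes a `C²` map `f` on `ℝ × range I` with `∂ₜ f = v ∘ f`, and the only fact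
needed about it is the equation of first variation `∂ₜ (D f) = D v ∘ D f`, which is the symmetry of
the mixed second derivatives of `f` (`hasDerivAt_fderivWithin_of_flow`). It holds up to the boundary
because `range I` is the closure of its interior. The charts depend on the point, so the
derivative of the integrand is computed pointwise, in the chart at the image point, while a chart
fixed at a nearby point serves only to show that the integrand and this derivative are continuous
(`continuousAt_form_along_curve`). This justifies differentiation under the integral sign.

For a density carried along by the flow, `η_t^* (D_t dV)` does not depend on time. In charts its
coefficient is `D ρ |det D f|`, and by the equation of first variation and Jacobi's formula its
time derivative is `(∂ₜ D + div (D u)) ρ |det D f|`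
(`PushForwardRelation.continuityEquation`). The last two factors do not vanish.
-/

namespace KelvinNoether

open Set Filter Topology

section Calculus

variable {E : Type*} [NormedAddCommGroup E] [NormedSpace ℝ E]
  {F : Type*} [NormedAddCommGroup F] [NormedSpace ℝ F]

/-! ### Jacobi's formula -/

theorem _root_.ContinuousLinearMap.differentiable_det [FiniteDimensional ℝ E] :
    Differentiable ℝ (fun A : E →L[ℝ] E => A.det) := by
  let b := Module.finBasis ℝ E
  let entryL : Fin (Module.finrank ℝ E) → Fin (Module.finrank ℝ E) → (E →L[ℝ] E) →L[ℝ] ℝ :=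
    fun i j => (LinearMap.toContinuousLinearMap (b.coord i)).comp
      (ContinuousLinearMap.apply ℝ E (b j))
  have h : (fun A : E →L[ℝ] E => A.det) =
      fun A => (Matrix.of fun i j => entryL i j A).det := by
    funext A
    rw [ContinuousLinearMap.det, ← LinearMap.det_toMatrix b]
    congr 1
    ext i j
    simp [entryL, LinearMap.toMatrix_apply]
  rw [h]
  simp only [Matrix.det_apply, Matrix.of_apply]
  fun_prop

/-- Jacobi's formula at the identity. -/
theorem _root_.ContinuousLinearMap.fderiv_det_one_apply [FiniteDimensional ℝ E] (A : E →L[ℝ] E) :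
    fderiv ℝ (fun A : E →L[ℝ] E => A.det) 1 A = LinearMap.trace ℝ E A.toLinearMap := by
  have h1 : HasDerivAt (fun r : ℝ => (1 + r • A : E →L[ℝ] E).det)
      (fderiv ℝ (fun A : E →L[ℝ] E => A.det) 1 A) 0 := by
    have hd := (ContinuousLinearMap.differentiable_det (E := E) (1 + (0 : ℝ) • A)).hasFDerivAt
    have hc : HasDerivAt (fun r : ℝ => (1 + r • A : E →L[ℝ] E)) A 0 := by
      simpa using ((hasDerivAt_id (0 : ℝ)).smul_const A).const_add 1
    have h := hd.comp_hasDerivAt (0 : ℝ) hc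
    simp only [zero_smul, add_zero] at h
    exact h
  let b := Module.finBasis ℝ E
  let B := LinearMap.toMatrix b b A.toLinearMap
  have h2 : ∀ r : ℝ, (1 + r • A : E →L[ℝ] E).det = (1 + r • B).det := by
    intro r
    rw [ContinuousLinearMap.det, ← LinearMap.det_toMatrix b]
    congr 1
    simp only [ContinuousLinearMap.toLinearMap_add, ContinuousLinearMap.toLinearMap_smul, map_add,
      map_smul, B]
    congr 1
    exact LinearMap.toMatrix_one b
  have h3 : HasDerivAt (fun r : ℝ => (1 + r • A : E →L[ℝ] E).det) B.trace 0 := by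
    have h2' : (fun r : ℝ => (1 + r • A : E →L[ℝ] E).det) = _ :=
      funext fun r => (h2 r).trans (Matrix.det_one_add_smul r B)
    rw [h2']
    have hp := (Polynomial.hasDerivAt
      (Matrix.det (1 + (Polynomial.X : Polynomial ℝ) • B.map Polynomial.C)).divX.divX
      (0 : ℝ)).mul ((hasDerivAt_id (0 : ℝ)).pow 2)
    have hl := ((hasDerivAt_id (0 : ℝ)).const_mul B.trace).const_add 1
    refine ((hl.add hp).congr_deriv (by simp)).congr_of_eventuallyEq ?_
    exact Eventually.of_forall fun r => by simp
  rw [h1.unique h3, LinearMap.trace_eq_matrix_trace ℝ b]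

/-- Jacobi's formula for a solution of the linear equation `P' = A P`. -/
theorem _root_.HasDerivAt.clm_det [FiniteDimensional ℝ E] {P : ℝ → E →L[ℝ] E} {A : E →L[ℝ] E}
    {t : ℝ} (hP : HasDerivAt P (A.comp (P t)) t) (hinv : (P t).IsInvertible) :
    HasDerivAt (fun σ => (P σ).det) (LinearMap.trace ℝ E A.toLinearMap * (P t).det) t := by
  obtain ⟨e, he⟩ := hinv
  -- dividing by `P t` reduces to the derivative of the determinant at the identity
  have hQ : HasDerivAt (fun σ => (P σ).comp (e.symm : E →L[ℝ] E)) A t := by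
    have := hP.clm_comp (hasDerivAt_const t (e.symm : E →L[ℝ] E))
    convert this using 1
    rw [← he]
    ext v
    simp
  have h1 : (P t).comp (e.symm : E →L[ℝ] E) = 1 := by
    rw [← he]
    ext v
    simp
  have hd := (ContinuousLinearMap.differentiable_det (E := E)
    ((P t).comp (e.symm : E →L[ℝ] E))).hasFDerivAt.comp_hasDerivAt t hQ
  rw [h1, ContinuousLinearMap.fderiv_det_one_apply] at hd
  refine (hd.mul_const (P t).det).congr_of_eventuallyEq (Eventually.of_forall fun σ => ?_)
  simp only [Function.comp, ContinuousLinearMap.det, ← LinearMap.det_comp]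
  congr 1
  rw [← he]
  ext v
  simp

/-! ### Calculus on the product of the time axis and a set -/

/-- The space derivative of a function on `ℝ × R` is its full derivative restricted to
`0 × E`. -/
theorem fderivWithin_slice {R : Set E} (hR : UniqueDiffOn ℝ R) {f : ℝ × E → F} {p : ℝ × E}
    (hp : p.2 ∈ R) (hf : DifferentiableWithinAt ℝ f (univ ×ˢ R) p) :
    fderivWithin ℝ (fun e => f (p.1, e)) R p.2 =
      (fderivWithin ℝ f (univ ×ˢ R) p).comp (ContinuousLinearMap.inr ℝ ℝ E) := by
  refine HasFDerivWithinAt.fderivWithin ?_ (hR _ hp)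
  exact HasFDerivWithinAt.comp (t := univ ×ˢ R) p.2 hf.hasFDerivWithinAt
    (hasFDerivAt_prodMk_right p.1 p.2).hasFDerivWithinAt (fun e he => ⟨mem_univ _, he⟩)

/-- The time derivative of a function on `ℝ × R` is its full derivative applied to `(1, 0)`. -/
theorem hasDerivAt_slice {R : Set E} {f : ℝ × E → F} {p : ℝ × E}
    (hp : p.2 ∈ R) (hf : DifferentiableWithinAt ℝ f (univ ×ˢ R) p) :
    HasDerivAt (fun σ => f (σ, p.2)) (fderivWithin ℝ f (univ ×ˢ R) p (1, 0)) p.1 := by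
  have h := HasFDerivWithinAt.comp_hasDerivWithinAt (t := univ ×ˢ R) (s := univ) p.1
    (f := fun σ => (σ, p.2)) (f' := ((1 : ℝ), (0 : E))) (l := f) hf.hasFDerivWithinAt
    (((hasDerivAt_id p.1).prodMk (hasDerivAt_const p.1 p.2)).hasDerivWithinAt)
    (fun σ _ => ⟨mem_univ _, hp⟩)
  exact hasDerivWithinAt_univ.1 h

/-- The chain rule along a curve in `R`, with the time and the space derivatives separated. -/
theorem hasDerivAt_along_curve {R : Set E} (hR : UniqueDiffOn ℝ R) {G : ℝ × E → F}
    {y : ℝ → E} {w : E} {t : ℝ} {g : F} (hy : HasDerivAt y w t) (hyR : ∀ᶠ σ in 𝓝 t, y σ ∈ R)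
    (hG : DifferentiableWithinAt ℝ G (univ ×ˢ R) (t, y t))
    (hg : HasDerivAt (fun σ => G (σ, y t)) g t) :
    HasDerivAt (fun σ => G (σ, y σ))
      (g + fderivWithin ℝ (fun e => G (t, e)) R (y t) w) t := by
  have hyt : y t ∈ R := hyR.self_of_nhds
  have h1 := (hasDerivAt_slice (p := (t, y t)) hyt hG).unique hg
  have h2 := fderivWithin_slice hR (p := (t, y t)) hyt hG
  have h := HasFDerivWithinAt.comp_hasDerivWithinAt (t := univ ×ˢ R) (s := {σ | y σ ∈ R}) t
    (f := fun σ => (σ, y σ)) (f' := ((1 : ℝ), w)) (l := G) hG.hasFDerivWithinAt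
    (((hasDerivAt_id t).prodMk hy).hasDerivWithinAt)
    (fun σ hσ => ⟨mem_univ _, hσ⟩)
  have h' := h.hasDerivAt hyR
  simp only at h2
  rw [h2, ← h1, ContinuousLinearMap.comp_apply, ← map_add]
  simpa [Function.comp_def] using h'

theorem _root_.ContDiffWithinAt.fderivWithin_slice {R : Set E} (hR : UniqueDiffOn ℝ R)
    {f : ℝ × E → F} {p : ℝ × E} (hp : p.2 ∈ R) (hf : ContDiffWithinAt ℝ 2 f (univ ×ˢ R) p) :
    ContDiffWithinAt ℝ 1 (fun q : ℝ × E => fderivWithin ℝ (fun e => f (q.1, e)) R q.2)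
      (univ ×ˢ R) p := by
  have hpS : p ∈ (univ : Set ℝ) ×ˢ R := ⟨mem_univ _, hp⟩
  have hS : UniqueDiffOn ℝ ((univ : Set ℝ) ×ˢ R) := uniqueDiffOn_univ.prod hR
  have h1 : ContDiffWithinAt ℝ 1 (fderivWithin ℝ f (univ ×ˢ R)) (univ ×ˢ R) p :=
    hf.fderivWithin_right hS (by norm_num) hpS
  have h2 : ContDiffWithinAt ℝ 1 (fun q => (fderivWithin ℝ f (univ ×ˢ R) q).comp
      (ContinuousLinearMap.inr ℝ ℝ E)) (univ ×ˢ R) p :=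
    h1.clm_comp contDiffWithinAt_const
  refine h2.congr_of_eventuallyEq_of_mem ?_ hpS
  filter_upwards [insert_eq_of_mem hpS ▸ hf.eventually (by simp), self_mem_nhdsWithin]
    with q hq hqS
  exact KelvinNoether.fderivWithin_slice hR hqS.2 (hq.differentiableWithinAt (by norm_num))

/-- The equation of first variation, `∂ₜ (D f) = D v ∘ D f`, for a flow with `∂ₜ f = v ∘ f`. This
is the symmetry of the mixed second derivatives of `f`. -/
theorem hasDerivAt_fderivWithin_of_flow {R : Set E} (hR : UniqueDiffOn ℝ R)
    (hRi : R ⊆ closure (interior R)) {f v : ℝ × E → E} {t : ℝ} {e : E} (he : e ∈ R)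
    (hf : ContDiffWithinAt ℝ 2 f (univ ×ˢ R) (t, e)) (hmaps : ∀ᶠ z in 𝓝[R] e, f (t, z) ∈ R)
    (hv : DifferentiableWithinAt ℝ v (univ ×ˢ R) (t, f (t, e)))
    (hflow : ∀ᶠ z in 𝓝[R] e, HasDerivAt (fun σ => f (σ, z)) (v (t, f (t, z))) t) :
    HasDerivAt (fun σ => fderivWithin ℝ (fun z => f (σ, z)) R e)
      ((fderivWithin ℝ (fun y => v (t, y)) R (f (t, e))).comp
        (fderivWithin ℝ (fun z => f (t, z)) R e)) t := by
  have hpS : (t, e) ∈ (univ : Set ℝ) ×ˢ R := ⟨mem_univ _, he⟩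
  have hS : UniqueDiffOn ℝ ((univ : Set ℝ) ×ˢ R) := uniqueDiffOn_univ.prod hR
  have hf1 : DifferentiableWithinAt ℝ f (univ ×ˢ R) (t, e) :=
    hf.differentiableWithinAt (by norm_num)
  have h1 : DifferentiableWithinAt ℝ (fderivWithin ℝ f (univ ×ˢ R)) (univ ×ˢ R) (t, e) :=
    (hf.fderivWithin_right (m := 1) hS (by norm_num) hpS).differentiableWithinAt (by norm_num)
  have hsymm : IsSymmSndFDerivWithinAt ℝ f (univ ×ˢ R) (t, e) := by
    refine hf.isSymmSndFDerivWithinAt (by simp) hS ?_ hpS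
    rw [interior_prod_eq, closure_prod_eq]
    exact ⟨by simp, hRi he⟩
  have hdiff : ∀ᶠ q in 𝓝[univ ×ˢ R] (t, e), DifferentiableWithinAt ℝ f (univ ×ˢ R) q := by
    filter_upwards [insert_eq_of_mem hpS ▸ hf.eventually (by simp), self_mem_nhdsWithin]
      with q hq hqS
    exact hq.differentiableWithinAt (by norm_num)
  -- the time derivative of the space derivative
  have hL : HasDerivAt (fun σ => fderivWithin ℝ (fun z => f (σ, z)) R e)
      ((fderivWithin ℝ (fderivWithin ℝ f (univ ×ˢ R)) (univ ×ˢ R) (t, e) (1, 0)).comp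
        (ContinuousLinearMap.inr ℝ ℝ E)) t := by
    have h2 := (hasDerivAt_slice (p := (t, e)) he h1).clm_comp
      (hasDerivAt_const t (ContinuousLinearMap.inr ℝ ℝ E))
    have h3 : Tendsto (fun σ : ℝ => (σ, e)) (𝓝 t) (𝓝[univ ×ˢ R] (t, e)) := by
      refine tendsto_nhdsWithin_iff.2 ⟨?_, Eventually.of_forall fun σ => ⟨mem_univ _, he⟩⟩
      exact (continuous_id.prodMk continuous_const).tendsto' _ _ rfl
    refine HasDerivAt.congr_of_eventuallyEq (by simpa using h2) ?_
    filter_upwards [h3.eventually hdiff] with σ hσ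
    exact KelvinNoether.fderivWithin_slice hR (p := (σ, e)) he hσ
  -- the space derivative of the time derivative
  have hfs : HasFDerivWithinAt (fun z => f (t, z)) (fderivWithin ℝ (fun z => f (t, z)) R e)
      R e := by
    have := HasFDerivWithinAt.comp (t := univ ×ˢ R) e hf1.hasFDerivWithinAt
      (hasFDerivAt_prodMk_right t e).hasFDerivWithinAt (fun z hz => ⟨mem_univ _, hz⟩)
    exact this.differentiableWithinAt.hasFDerivWithinAt
  have hvs : HasFDerivWithinAt (fun y => v (t, y))
      (fderivWithin ℝ (fun y => v (t, y)) R (f (t, e))) R (f (t, e)) := by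
    have := HasFDerivWithinAt.comp (t := univ ×ˢ R) (f (t, e)) hv.hasFDerivWithinAt
      (hasFDerivAt_prodMk_right t (f (t, e))).hasFDerivWithinAt (fun z hz => ⟨mem_univ _, hz⟩)
    exact this.differentiableWithinAt.hasFDerivWithinAt
  have hR1 : HasFDerivWithinAt (fun z => v (t, f (t, z)))
      ((fderivWithin ℝ (fun y => v (t, y)) R (f (t, e))).comp
        (fderivWithin ℝ (fun z => f (t, z)) R e)) R e :=
    HasFDerivWithinAt.comp_of_tendsto (f := fun z => f (t, z)) (g := fun y => v (t, y)) e hvs hfs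
      (tendsto_nhdsWithin_iff.2 ⟨hfs.continuousWithinAt.tendsto, hmaps⟩)
  have hR2 : HasFDerivWithinAt (fun z => fderivWithin ℝ f (univ ×ˢ R) (t, z) (1, 0))
      (((fderivWithin ℝ (fderivWithin ℝ f (univ ×ˢ R)) (univ ×ˢ R) (t, e)).comp
        (ContinuousLinearMap.inr ℝ ℝ E)).flip (1, 0)) R e := by
    have h2 := HasFDerivWithinAt.comp (t := univ ×ˢ R) e h1.hasFDerivWithinAt
      (hasFDerivAt_prodMk_right t e).hasFDerivWithinAt (fun z hz => ⟨mem_univ _, hz⟩)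
    have h3 := h2.clm_apply (hasFDerivWithinAt_const ((1 : ℝ), (0 : E)) e R)
    simpa using h3
  have h4 : Tendsto (fun z : E => (t, z)) (𝓝[R] e) (𝓝[univ ×ˢ R] (t, e)) := by
    refine tendsto_nhdsWithin_iff.2 ⟨?_, ?_⟩
    · exact ((continuous_const.prodMk continuous_id).tendsto' _ _ rfl).mono_left nhdsWithin_le_nhds
    · filter_upwards [self_mem_nhdsWithin] with z hz using ⟨mem_univ _, hz⟩
  have heq : (fun z => v (t, f (t, z))) =ᶠ[𝓝[R] e]
      fun z => fderivWithin ℝ f (univ ×ˢ R) (t, z) (1, 0) := by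
    filter_upwards [hflow, h4.eventually hdiff, self_mem_nhdsWithin] with z hz hz' hzR
    exact hz.unique (hasDerivAt_slice (p := (t, z)) hzR hz')
  -- both expressions for the velocity have the same space derivative
  have hkey := (hR e he).eq hR1
    (hR2.congr_of_eventuallyEq heq (heq.self_of_nhdsWithin he))
  convert hL using 1
  rw [hkey]
  ext w
  simpa using hsymm (0, w) (1, 0)

/-! ### Differentiation under the integral sign -/

/-- Differentiation of a parametric integral whose integrand has a continuous derivative. -/
theorem hasDerivAt_intervalIntegral_of_continuousAt {g g' : ℝ → ℝ → ℝ} {J : Set ℝ} (hJ : IsOpen J)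
    {a b t : ℝ} (ht : t ∈ J) (hg : ∀ σ ∈ J, Continuous (g σ))
    (hd : ∀ σ ∈ J, ∀ s, HasDerivAt (fun σ' => g σ' s) (g' σ s) σ)
    (hg' : ∀ s, ContinuousAt (fun p : ℝ × ℝ => g' p.1 p.2) (t, s)) :
    HasDerivAt (fun σ => ∫ s in a..b, g σ s) (∫ s in a..b, g' t s) t := by
  -- by compactness, the derivative is bounded near `{t} × [a, b]`
  have hloc : ∀ s ∈ uIcc a b, ∃ C : ℝ, ∀ᶠ p : ℝ × ℝ in 𝓝 t ×ˢ 𝓝[uIcc a b] s,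
      ‖g' p.1 p.2‖ ≤ C := by
    intro s _
    refine ⟨‖g' t s‖ + 1, ?_⟩
    have h := (hg' s).norm.eventually (ge_mem_nhds (lt_add_one _))
    rw [nhds_prod_eq] at h
    exact (Filter.prod_mono le_rfl nhdsWithin_le_nhds) h
  have hbd : ∃ C : ℝ, ∀ᶠ σ in 𝓝 t, ∀ s ∈ uIcc a b, ‖g' σ s‖ ≤ C := by
    refine isCompact_uIcc.induction_on (p := fun K => ∃ C : ℝ, ∀ᶠ σ in 𝓝 t, ∀ s ∈ K,
      ‖g' σ s‖ ≤ C) ⟨0, by simp⟩ ?_ ?_ ?_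
    · rintro K K' hK ⟨C, hC⟩
      exact ⟨C, hC.mono fun σ h s hs => h s (hK hs)⟩
    · rintro K K' ⟨C, hC⟩ ⟨C', hC'⟩
      refine ⟨max C C', ?_⟩
      filter_upwards [hC, hC'] with σ h h' s hs
      rcases hs with hs | hs
      · exact (h s hs).trans (le_max_left _ _)
      · exact (h' s hs).trans (le_max_right _ _)
    · intro s hs
      obtain ⟨C, hC⟩ := hloc s hs
      obtain ⟨A, hA, B, hB, hAB⟩ := Filter.mem_prod_iff.1 hC
      exact ⟨B, hB, C, by filter_upwards [hA] with σ hσ s' hs' using hAB (mk_mem_prod hσ hs')⟩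
  obtain ⟨C, hC⟩ := hbd
  have hU : {σ | σ ∈ J ∧ ∀ s ∈ uIcc a b, ‖g' σ s‖ ≤ C} ∈ 𝓝 t :=
    inter_mem (hJ.mem_nhds ht) hC
  refine (intervalIntegral.hasDerivAt_integral_of_dominated_loc_of_deriv_le
    (bound := fun _ => C) hU ?_ ?_ ?_ ?_ ?_ ?_).2
  · filter_upwards [hJ.mem_nhds ht] with σ hσ using (hg σ hσ).aestronglyMeasurable
  · exact (hg t ht).intervalIntegrable _ _
  · refine Continuous.aestronglyMeasurable ?_
    exact continuous_iff_continuousAt.2 fun s =>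
      (hg' s).comp (f := fun s => (t, s)) (continuousAt_const.prodMk continuousAt_id)
  · exact Eventually.of_forall fun s hs σ hσ => hσ.2 s (uIoc_subset_uIcc hs)
  · exact intervalIntegrable_const
  · exact Eventually.of_forall fun s _ σ hσ => hd σ hσ.1 s

/-- A time-dependent one-form `N` of class `C¹` on `R`, evaluated along a `C¹` curve `c` in `R`, is
continuous in time and in the parameter, and so is its time derivative. -/
theorem continuousAt_form_along_curve {R : Set E} (hR : UniqueDiffOn ℝ R)
    {N : ℝ × E → E →L[ℝ] ℝ} {c : ℝ → E} {t s : ℝ} (hcR : ∀ s, c s ∈ R) (hc : ContDiffAt ℝ 1 c s)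
    (hN : ContDiffWithinAt ℝ 1 N (univ ×ˢ R) (t, c s)) {g g' : ℝ × ℝ → ℝ}
    (hg : ∀ᶠ q in 𝓝 (t, s), g q = N (q.1, c q.2) (deriv c q.2))
    (hg' : ∀ᶠ q in 𝓝 (t, s), HasDerivAt (fun σ => g (σ, q.2)) (g' q) q.1) :
    ContinuousAt g (t, s) ∧ ContinuousAt g' (t, s) := by
  have hpS : (t, c s) ∈ (univ : Set ℝ) ×ˢ R := ⟨mem_univ _, hcR s⟩
  have hS : UniqueDiffOn ℝ ((univ : Set ℝ) ×ˢ R) := uniqueDiffOn_univ.prod hR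
  have htend : Tendsto (fun q : ℝ × ℝ => (q.1, c q.2)) (𝓝 (t, s)) (𝓝[univ ×ˢ R] (t, c s)) := by
    refine tendsto_nhdsWithin_iff.2 ⟨?_, Eventually.of_forall fun q => ⟨mem_univ _, hcR _⟩⟩
    exact continuousAt_fst.prodMk (hc.continuousAt.comp (f := Prod.snd) (x := (t, s))
      continuousAt_snd)
  have hc' : ContinuousAt (fun q : ℝ × ℝ => deriv c q.2) (t, s) := by
    have h1 : ContDiffAt ℝ 0 (fderiv ℝ c) s := hc.fderiv_right (by norm_num)
    have h2 : ContinuousAt (fun s => fderiv ℝ c s 1) s :=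
      h1.continuousAt.clm_apply continuousAt_const
    exact ContinuousAt.comp (f := Prod.snd) (x := (t, s)) h2 continuousAt_snd
  constructor
  · have h1 : ContinuousAt (fun q : ℝ × ℝ => N (q.1, c q.2)) (t, s) :=
      hN.continuousWithinAt.tendsto.comp htend
    exact (h1.clm_apply hc').congr (hg.mono fun q hq => hq.symm)
  · have h1 : ContinuousAt (fun q : ℝ × ℝ => fderivWithin ℝ N (univ ×ˢ R) (q.1, c q.2)) (t, s) :=
      (hN.fderivWithin_right (m := 0) hS (by norm_num) hpS).continuousWithinAt.tendsto.comp htend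
    have h2 : ContinuousAt (fun q : ℝ × ℝ =>
        fderivWithin ℝ N (univ ×ˢ R) (q.1, c q.2) (1, 0) (deriv c q.2)) (t, s) :=
      (h1.clm_apply continuousAt_const).clm_apply hc'
    refine h2.congr ?_
    have hdiff : ∀ᶠ p in 𝓝[univ ×ˢ R] (t, c s), DifferentiableWithinAt ℝ N (univ ×ˢ R) p := by
      filter_upwards [insert_eq_of_mem hpS ▸ hN.eventually (by simp)] with p hp
      exact hp.differentiableWithinAt (by norm_num)
    filter_upwards [hg', hg.eventually_nhds, htend.eventually hdiff] with q hq hq2 hq3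
    have h3 : HasDerivAt (fun σ => N (σ, c q.2) (deriv c q.2))
        (fderivWithin ℝ N (univ ×ˢ R) (q.1, c q.2) (1, 0) (deriv c q.2)) q.1 := by
      have := (hasDerivAt_slice (p := (q.1, c q.2)) (hcR _) hq3).clm_apply
        (hasDerivAt_const q.1 (deriv c q.2))
      simpa using this
    refine (h3.congr_of_eventuallyEq ?_).unique hq
    have h4 : Tendsto (fun σ => (σ, q.2)) (𝓝 q.1) (𝓝 q) :=
      (continuous_id.prodMk continuous_const).tendsto' _ _ rfl
    exact h4.eventually hq2

end Calculus

section Manifold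

variable {n : ℕ} {H : Type*} [TopologicalSpace H]
  {I : ModelWithCorners ℝ (EuclideanSpace ℝ (Fin n)) H}
  {M : Type*} [TopologicalSpace M] [ChartedSpace H M] [IsManifold I ∞ M]

local notation "𝔼" => EuclideanSpace ℝ (Fin n)

/-! ### Fields in charts -/

theorem isManifold_one_of_infty : IsManifold I 1 M := IsManifold.of_le (n := ∞) (by simp)

theorem chartDeriv_self (x : M) :
    chartDeriv I x (extChartAt I x x) = ContinuousLinearMap.id ℝ 𝔼 := by
  have := isManifold_one_of_infty (I := I) (M := M)
  exact mfderivWithin_range_extChartAt_symm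

/-- Fields on `ℝ × M` read in a chart are functions on `ℝ × range I`. -/
theorem _root_.ContMDiffAt.comp_extChartAt_symm {F : Type*} [NormedAddCommGroup F]
    [NormedSpace ℝ F] {k : ℕ∞ω} (hk : k ≤ ∞) {t : ℝ} {x : M} {g : ℝ × M → F}
    (hg : ContMDiffAt (𝓘(ℝ, ℝ).prod I) 𝓘(ℝ, F) k g (t, x)) :
    ContDiffWithinAt ℝ k (fun p : ℝ × 𝔼 => g (p.1, (extChartAt I x).symm p.2))
      (univ ×ˢ range I) (t, extChartAt I x x) := by
  have : IsManifold I k M := IsManifold.of_le (n := ∞) hk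
  have hs : ContMDiffWithinAt (𝓘(ℝ, ℝ).prod 𝓘(ℝ, 𝔼)) I k
      (fun p : ℝ × 𝔼 => (extChartAt I x).symm p.2) (univ ×ˢ range I) (t, extChartAt I x x) :=
    ContMDiffWithinAt.comp (t := range I) (t, extChartAt I x x)
      (contMDiffWithinAt_extChartAt_symm_range_self x) contMDiffWithinAt_snd (fun p hp => hp.2)
  have h : ContMDiffWithinAt (𝓘(ℝ, ℝ).prod 𝓘(ℝ, 𝔼)) 𝓘(ℝ, F) k
      (fun p : ℝ × 𝔼 => g (p.1, (extChartAt I x).symm p.2)) (univ ×ˢ range I)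
      (t, extChartAt I x x) :=
    ContMDiffAt.comp_contMDiffWithinAt_of_eq (x := (t, extChartAt I x x)) (y := (t, x)) hg
      (contMDiffWithinAt_fst.prodMk hs) (by simp)
  rwa [← modelWithCornersSelf_prod, chartedSpaceSelf_prod, contMDiffWithinAt_iff_contDiffWithinAt]
    at h

omit [IsManifold I ∞ M] in
theorem eventually_mem_extChartAt_target (t : ℝ) (x : M) :
    ∀ᶠ p : ℝ × 𝔼 in 𝓝[univ ×ˢ range I] (t, extChartAt I x x), p.2 ∈ (extChartAt I x).target := by
  have h : Tendsto (fun p : ℝ × 𝔼 => p.2) (𝓝[univ ×ˢ range I] (t, extChartAt I x x))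
      (𝓝[range I] (extChartAt I x x)) :=
    tendsto_nhdsWithin_iff.2 ⟨(continuous_snd.tendsto' _ _ rfl).mono_left nhdsWithin_le_nhds,
      by filter_upwards [self_mem_nhdsWithin] with p hp using hp.2⟩
  exact h.eventually (extChartAt_target_mem_nhdsWithin x)

omit [IsManifold I ∞ M] in
theorem mem_univ_prod_range (t : ℝ) (x : M) :
    (t, extChartAt I x x) ∈ (univ : Set ℝ) ×ˢ range I :=
  ⟨mem_univ _, extChartAt_target_subset_range x (mem_extChartAt_target x)⟩

/-- The components of a jointly `C¹` vector field are its second coordinate in the trivialization of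
the tangent bundle, because the inverse of `chartDeriv` is the differential of the chart. -/
theorem JointlyC1Vector.contDiffWithinAt_vecRep {J : Set ℝ} (hJ : IsOpen J)
    {u : ℝ → (y : M) → TangentSpace I y} (hu : JointlyC1Vector J u) {t : ℝ} (ht : t ∈ J) (x : M) :
    ContDiffWithinAt ℝ 1 (fun p : ℝ × 𝔼 => vecRep I x (u p.1) p.2) (univ ×ˢ range I)
      (t, extChartAt I x x) := by
  have := isManifold_one_of_infty (I := I) (M := M)
  have h := (hu (t, x) ⟨ht, mem_univ _⟩).contMDiffAt
    (prod_mem_nhds (hJ.mem_nhds ht) univ_mem)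
  have h2 := (Bundle.contMDiffAt_totalSpace.1 h).2.comp_extChartAt_symm (by simp)
  refine h2.congr_of_eventuallyEq_of_mem ?_ (mem_univ_prod_range t x)
  filter_upwards [eventually_mem_extChartAt_target t x] with p hp
  have hps : (extChartAt I x).symm p.2 ∈ (chartAt H x).source := by
    rw [← extChartAt_source (I := I)]; exact (extChartAt I x).map_target hp
  have hA := TangentBundle.continuousLinearMapAt_trivializationAt (I := I) hps
  have hB : (chartDeriv I x p.2).inverse = mfderiv I 𝓘(ℝ, 𝔼) (extChartAt I x)
      ((extChartAt I x).symm p.2) :=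
    ContinuousLinearMap.inverse_eq
      (mfderivWithin_extChartAt_symm_comp_mfderiv_extChartAt hp)
      (mfderiv_extChartAt_comp_mfderivWithin_extChartAt_symm hp)
  have hC : ∀ w : TangentSpace I ((extChartAt I x).symm p.2),
      (trivializationAt 𝔼 (TangentSpace I) x).continuousLinearMapAt ℝ
        ((extChartAt I x).symm p.2) w =
      (trivializationAt 𝔼 (TangentSpace I) x ⟨(extChartAt I x).symm p.2, w⟩).2 := by
    intro w
    rw [Bundle.Trivialization.continuousLinearMapAt_apply,
      Bundle.Trivialization.linearMapAt_apply, if_pos]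
    simpa using hps
  rw [vecRep, hB]
  exact (congrArg (fun L : TangentSpace I ((extChartAt I x).symm p.2) →L[ℝ] 𝔼 =>
    L (u p.1 ((extChartAt I x).symm p.2))) hA.symm).trans (hC _)

/-- The components of a jointly `C¹` one-form are its coordinates in the hom bundle, because
`chartDeriv` is the inverse trivialization of the tangent bundle. -/
theorem JointlyC1Form.contDiffWithinAt_formRep {J : Set ℝ} (hJ : IsOpen J)
    {m : ℝ → (y : M) → TangentSpace I y →L[ℝ] ℝ} (hm : JointlyC1Form J m) {t : ℝ} (ht : t ∈ J)
    (x : M) :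
    ContDiffWithinAt ℝ 1 (fun p : ℝ × 𝔼 => formRep I x (m p.1) p.2) (univ ×ˢ range I)
      (t, extChartAt I x x) := by
  have := isManifold_one_of_infty (I := I) (M := M)
  have h := (hm (t, x) ⟨ht, mem_univ _⟩).contMDiffAt
    (prod_mem_nhds (hJ.mem_nhds ht) univ_mem)
  have h2 := ((contMDiffAt_hom_bundle _).1 h).2.comp_extChartAt_symm (by simp)
  refine h2.congr_of_eventuallyEq_of_mem ?_ (mem_univ_prod_range t x)
  filter_upwards [eventually_mem_extChartAt_target t x] with p hp
  have hps : (extChartAt I x).symm p.2 ∈ (chartAt H x).source := by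
    rw [← extChartAt_source (I := I)]; exact (extChartAt I x).map_target hp
  have hA := TangentBundle.symmL_trivializationAt (I := I) hps
  rw [(extChartAt I x).right_inv hp] at hA
  simp only [ContinuousLinearMap.inCoordinates]
  rw [hA]
  ext v
  simp [formRep, chartDeriv]

omit [IsManifold I ∞ M] in
theorem formRep_extChartAt (x : M) (m : (y : M) → TangentSpace I y →L[ℝ] ℝ) {y : M}
    (hy : y ∈ (extChartAt I x).source) (w : 𝔼) :
    formRep I x m (extChartAt I x y) w = m y (chartDeriv I x (extChartAt I x y) w) := by
  -- the fibre depends on the base point, so `left_inv` is applied to a generalized base point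
  have h : ∀ y' : M, y' = y → m y' (chartDeriv I x (extChartAt I x y) w) =
      m y (chartDeriv I x (extChartAt I x y) w) := by
    rintro _ rfl
    rfl
  exact h _ ((extChartAt I x).left_inv hy)

theorem formRep_self (x : M) (m : (y : M) → TangentSpace I y →L[ℝ] ℝ) (w : 𝔼) :
    formRep I x m (extChartAt I x x) w = m x w := by
  rw [formRep_extChartAt x m (mem_extChartAt_source x), chartDeriv_self]
  rfl

theorem chartDeriv_mfderiv_extChartAt (x : M) {y : M} (hy : y ∈ (extChartAt I x).source) (w : 𝔼) :
    chartDeriv I x (extChartAt I x y) (mfderiv I 𝓘(ℝ, 𝔼) (extChartAt I x) y w) = w := by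
  have := isManifold_one_of_infty (I := I) (M := M)
  exact congrArg (fun L : 𝔼 →L[ℝ] 𝔼 => L w)
    (mfderivWithin_extChartAt_symm_comp_mfderiv_extChartAt' (I := I) hy)

theorem vecRep_extChartAt (x : M) (w : (y : M) → TangentSpace I y) {y : M}
    (hy : y ∈ (extChartAt I x).source) :
    vecRep I x w (extChartAt I x y) = mfderiv I 𝓘(ℝ, 𝔼) (extChartAt I x) y (w y) := by
  have := isManifold_one_of_infty (I := I) (M := M)
  have h : ∀ y' : M, y' = y → (w y' : 𝔼) = w y := by
    rintro _ rfl
    rfl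
  have hB : (chartDeriv I x (extChartAt I x y)).inverse =
      mfderiv I 𝓘(ℝ, 𝔼) (extChartAt I x) y :=
    ContinuousLinearMap.inverse_eq
      (mfderivWithin_extChartAt_symm_comp_mfderiv_extChartAt' hy)
      (mfderiv_extChartAt_comp_mfderivWithin_extChartAt_symm' hy)
  rw [vecRep, hB]
  exact congrArg _ (h _ ((extChartAt I x).left_inv hy))

omit [IsManifold I ∞ M] in
theorem densRep_extChartAt (x : M) (ρ : M → ℝ) {y : M} (hy : y ∈ (extChartAt I x).source) :
    densRep I x ρ (extChartAt I x y) = ρ y * |(chartDeriv I x (extChartAt I x y)).det| := by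
  rw [densRep, (extChartAt I x).left_inv hy]

/-! ### Flows in charts -/

variable (I) in
/-- The time-dependent map `φ`, read in the preferred charts at `X` (source) and at `x`
(target). -/
noncomputable def chartFlow (φ : ℝ → M → M) (X x : M) (p : ℝ × EuclideanSpace ℝ (Fin n)) :
    EuclideanSpace ℝ (Fin n) :=
  extChartAt I x (φ p.1 ((extChartAt I X).symm p.2))

variable (I) in
/-- The differential of `φ` at fixed time in the charts at `X` and at `x`. -/
noncomputable def chartFlowDeriv (φ : ℝ → M → M) (X x : M)
    (p : ℝ × EuclideanSpace ℝ (Fin n)) :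
    EuclideanSpace ℝ (Fin n) →L[ℝ] EuclideanSpace ℝ (Fin n) :=
  fderivWithin ℝ (fun z => chartFlow I φ X x (p.1, z)) (range I) p.2

variable {φ : ℝ → M → M} {J : Set ℝ}

omit [IsManifold I ∞ M] in
theorem contMDiff_of_jointly
    (hφ : ContMDiffOn (𝓘(ℝ, ℝ).prod I) I 2 (fun p : ℝ × M => φ p.1 p.2) (J ×ˢ univ)) {t : ℝ}
    (ht : t ∈ J) : ContMDiff I I 2 (φ t) := by
  intro X
  have h1 : ContMDiffWithinAt I (𝓘(ℝ, ℝ).prod I) 2 (fun Y : M => (t, Y)) univ X :=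
    (contMDiff_const.prodMk contMDiff_id).contMDiffAt
  exact ((hφ (t, X) ⟨ht, mem_univ _⟩).comp X h1 (fun Y _ => ⟨ht, mem_univ _⟩)).contMDiffAt univ_mem

omit [IsManifold I ∞ M] in
theorem contMDiffAt_of_jointly (hJ : IsOpen J)
    (hφ : ContMDiffOn (𝓘(ℝ, ℝ).prod I) I 2 (fun p : ℝ × M => φ p.1 p.2) (J ×ˢ univ)) {t : ℝ}
    (ht : t ∈ J) (X : M) :
    ContMDiffAt (𝓘(ℝ, ℝ).prod I) I 2 (fun p : ℝ × M => φ p.1 p.2) (t, X) :=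
  (hφ (t, X) ⟨ht, mem_univ _⟩).contMDiffAt (prod_mem_nhds (hJ.mem_nhds ht) univ_mem)

theorem contDiffWithinAt_chartFlow (hJ : IsOpen J)
    (hφ : ContMDiffOn (𝓘(ℝ, ℝ).prod I) I 2 (fun p : ℝ × M => φ p.1 p.2) (J ×ˢ univ)) {t : ℝ}
    (ht : t ∈ J) (X : M) :
    ContDiffWithinAt ℝ 2 (chartFlow I φ X (φ t X)) (univ ×ˢ range I) (t, extChartAt I X X) := by
  have h2 : (2 : ℕ∞ω) ≤ ∞ := WithTop.coe_le_coe.2 le_top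
  have : IsManifold I 2 M := IsManifold.of_le h2
  have h : ContMDiffAt (𝓘(ℝ, ℝ).prod I) 𝓘(ℝ, 𝔼) 2
      (fun p : ℝ × M => extChartAt I (φ t X) (φ p.1 p.2)) (t, X) :=
    ContMDiffAt.comp (t, X) (g := extChartAt I (φ t X)) contMDiffAt_extChartAt
      (contMDiffAt_of_jointly hJ hφ ht X)
  exact h.comp_extChartAt_symm h2

omit [IsManifold I ∞ M] in
theorem chartFlow_mem_range (X x : M) (p : ℝ × 𝔼) : chartFlow I φ X x p ∈ range I :=
  mem_range_self _

omit [IsManifold I ∞ M] in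
theorem chartFlow_extChartAt (X x : M) (σ : ℝ) {Y : M} (hY : Y ∈ (extChartAt I X).source) :
    chartFlow I φ X x (σ, extChartAt I X Y) = extChartAt I x (φ σ Y) := by
  simp only [chartFlow]
  rw [(extChartAt I X).left_inv hY]

/-- The chain rule for `mfderiv`, with both differentials expressed in charts. -/
theorem mfderiv_chartDeriv {f : M → M} {X x Y : M} (hY : Y ∈ (extChartAt I X).source)
    (hfY : f Y ∈ (extChartAt I x).source) (hf : MDifferentiableAt I I f Y) (w : 𝔼) :
    (mfderiv I I f Y (chartDeriv I X (extChartAt I X Y) w) : 𝔼) =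
      chartDeriv I x (extChartAt I x (f Y))
        (fderivWithin ℝ (fun z => extChartAt I x (f ((extChartAt I X).symm z))) (range I)
          (extChartAt I X Y) w) := by
  have := isManifold_one_of_infty (I := I) (M := M)
  have hYt := (extChartAt I X).map_source hY
  have h1 : HasMFDerivWithinAt 𝓘(ℝ, 𝔼) I (extChartAt I X).symm (range I) (extChartAt I X Y)
      (chartDeriv I X (extChartAt I X Y)) :=
    (mdifferentiableWithinAt_extChartAt_symm hYt).hasMFDerivWithinAt
  have hYinv := (extChartAt I X).left_inv hY
  have h2 : HasMFDerivAt I 𝓘(ℝ, 𝔼) (extChartAt I x ∘ f) Y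
      ((mfderiv I 𝓘(ℝ, 𝔼) (extChartAt I x) (f Y)).comp (mfderiv I I f Y)) :=
    ((mdifferentiableAt_extChartAt (by rwa [← extChartAt_source (I := I)])).hasMFDerivAt).comp Y
      hf.hasMFDerivAt
  let L : 𝔼 →L[ℝ] 𝔼 := (mfderiv I 𝓘(ℝ, 𝔼) (extChartAt I x) (f Y)).comp (mfderiv I I f Y)
  have h2' : ∀ Y', Y' = Y → HasMFDerivAt I 𝓘(ℝ, 𝔼) (extChartAt I x ∘ f) Y' L := by
    rintro _ rfl
    exact h2
  have h3 : HasFDerivWithinAt ((extChartAt I x ∘ f) ∘ (extChartAt I X).symm)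
      (L.comp (chartDeriv I X (extChartAt I X Y))) (range I) (extChartAt I X Y) :=
    (HasMFDerivAt.comp_hasMFDerivWithinAt (extChartAt I X Y) (h2' _ hYinv) h1).hasFDerivWithinAt
  have h4 := h3.fderivWithin
    (I.uniqueDiffOn _ (extChartAt_target_subset_range X hYt))
  have h5 : fderivWithin ℝ (fun z => extChartAt I x (f ((extChartAt I X).symm z))) (range I)
      (extChartAt I X Y) w = mfderiv I 𝓘(ℝ, 𝔼) (extChartAt I x) (f Y)
        (mfderiv I I f Y (chartDeriv I X (extChartAt I X Y) w)) :=
    congrArg (fun L : 𝔼 →L[ℝ] 𝔼 => L w) h4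
  rw [h5]
  exact (chartDeriv_mfderiv_extChartAt x hfY _).symm

theorem mfderiv_chartFlowDeriv {X x Y : M} {σ : ℝ} (hY : Y ∈ (extChartAt I X).source)
    (hfY : φ σ Y ∈ (extChartAt I x).source) (hf : MDifferentiableAt I I (φ σ) Y) (w : 𝔼) :
    (mfderiv I I (φ σ) Y (chartDeriv I X (extChartAt I X Y) w) : 𝔼) =
      chartDeriv I x (extChartAt I x (φ σ Y))
        (chartFlowDeriv I φ X x (σ, extChartAt I X Y) w) :=
  mfderiv_chartDeriv hY hfY hf w

/-- The velocity of a curve is the velocity of its chart representation. -/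
theorem mfderiv_curve_eq {X : M} {γ : ℝ → M} {s : ℝ} (hγ : MDifferentiableAt 𝓘(ℝ, ℝ) I γ s)
    (hs : γ s ∈ (extChartAt I X).source) :
    (mfderiv 𝓘(ℝ, ℝ) I γ s (1 : ℝ) : 𝔼) =
      chartDeriv I X (extChartAt I X (γ s)) (deriv (fun s => extChartAt I X (γ s)) s) := by
  have := isManifold_one_of_infty (I := I) (M := M)
  have h2 : HasMFDerivAt 𝓘(ℝ, ℝ) 𝓘(ℝ, 𝔼) (extChartAt I X ∘ γ) s
      ((mfderiv I 𝓘(ℝ, 𝔼) (extChartAt I X) (γ s)).comp (mfderiv 𝓘(ℝ, ℝ) I γ s)) :=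
    ((mdifferentiableAt_extChartAt (by rwa [← extChartAt_source (I := I)])).hasMFDerivAt).comp s
      hγ.hasMFDerivAt
  let L : ℝ →L[ℝ] 𝔼 :=
    (mfderiv I 𝓘(ℝ, 𝔼) (extChartAt I X) (γ s)).comp (mfderiv 𝓘(ℝ, ℝ) I γ s)
  have h2' : HasFDerivAt (fun s => extChartAt I X (γ s)) L s := hasMFDerivAt_iff_hasFDerivAt.1 h2
  have h3 : deriv (fun s => extChartAt I X (γ s)) s =
      mfderiv I 𝓘(ℝ, 𝔼) (extChartAt I X) (γ s) (mfderiv 𝓘(ℝ, ℝ) I γ s (1 : ℝ)) :=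
    h2'.hasDerivAt.deriv
  rw [h3]
  exact (chartDeriv_mfderiv_extChartAt X hs _).symm

variable {u : ℝ → (y : M) → TangentSpace I y}

/-- In charts, the flow satisfies `∂ₜ f = v ∘ f`. -/
theorem hasDerivAt_chartFlow {t : ℝ} {X x : M}
    (hvel : HasMFDerivAt 𝓘(ℝ, ℝ) I (fun σ => φ σ X) t
      (ContinuousLinearMap.toSpanSingleton ℝ (u t (φ t X))))
    (hx : φ t X ∈ (extChartAt I x).source) :
    HasDerivAt (fun σ => extChartAt I x (φ σ X))
      (vecRep I x (u t) (extChartAt I x (φ t X))) t := by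
  have := isManifold_one_of_infty (I := I) (M := M)
  have h2 : HasMFDerivAt 𝓘(ℝ, ℝ) 𝓘(ℝ, 𝔼) (extChartAt I x ∘ fun σ => φ σ X) t
      ((mfderiv I 𝓘(ℝ, 𝔼) (extChartAt I x) (φ t X)).comp
        (ContinuousLinearMap.toSpanSingleton ℝ (u t (φ t X)))) :=
    ((mdifferentiableAt_extChartAt (by rwa [← extChartAt_source (I := I)])).hasMFDerivAt).comp t
      hvel
  let L : ℝ →L[ℝ] 𝔼 :=
    (mfderiv I 𝓘(ℝ, 𝔼) (extChartAt I x) (φ t X)).comp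
      (ContinuousLinearMap.toSpanSingleton ℝ (u t (φ t X)))
  have h3 : HasFDerivAt (fun σ => extChartAt I x (φ σ X)) L t := hasMFDerivAt_iff_hasFDerivAt.1 h2
  rw [vecRep_extChartAt x (u t) hx]
  refine h3.hasDerivAt.congr_deriv ?_
  exact congrArg (mfderiv I 𝓘(ℝ, 𝔼) (extChartAt I x) (φ t X)) (one_smul ℝ (u t (φ t X)))

omit [IsManifold I ∞ M] in
theorem eventually_chartFlow_mem_source (hJ : IsOpen J)
    (hφ : ContMDiffOn (𝓘(ℝ, ℝ).prod I) I 2 (fun p : ℝ × M => φ p.1 p.2) (J ×ˢ univ)) {t : ℝ}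
    (ht : t ∈ J) (X : M) :
    ∀ᶠ p : ℝ × M in 𝓝 (t, X), p.2 ∈ (extChartAt I X).source ∧
      φ p.1 p.2 ∈ (extChartAt I (φ t X)).source := by
  have h1 : Tendsto (fun p : ℝ × M => p.2) (𝓝 (t, X)) (𝓝 X) := continuous_snd.tendsto' _ _ rfl
  have h2 : Tendsto (fun p : ℝ × M => φ p.1 p.2) (𝓝 (t, X)) (𝓝 (φ t X)) :=
    (contMDiffAt_of_jointly hJ hφ ht X).continuousAt
  exact (h1.eventually (extChartAt_source_mem_nhds X)).and
    (h2.eventually (extChartAt_source_mem_nhds _))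

/-- The equation of first variation for the flow `φ` of `u`, in charts. -/
theorem hasDerivAt_chartFlowDeriv (hJ : IsOpen J) (hu : JointlyC1Vector J u)
    (hφ : ContMDiffOn (𝓘(ℝ, ℝ).prod I) I 2 (fun p : ℝ × M => φ p.1 p.2) (J ×ˢ univ))
    (hvel : ∀ t ∈ J, ∀ X : M, HasMFDerivAt 𝓘(ℝ, ℝ) I (fun σ => φ σ X) t
      (ContinuousLinearMap.toSpanSingleton ℝ (u t (φ t X)))) {t : ℝ} (ht : t ∈ J) (X : M) :
    HasDerivAt (fun σ => chartFlowDeriv I φ X (φ t X) (σ, extChartAt I X X))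
      ((fderivWithin ℝ (vecRep I (φ t X) (u t)) (range I) (extChartAt I (φ t X) (φ t X))).comp
        (chartFlowDeriv I φ X (φ t X) (t, extChartAt I X X))) t := by
  have he : extChartAt I X X ∈ range I := mem_range_self _
  have hbase := chartFlow_extChartAt (φ := φ) (I := I) X (φ t X) t (mem_extChartAt_source X)
  have h := hasDerivAt_fderivWithin_of_flow (R := range I) I.uniqueDiffOn
    I.range_subset_closure_interior (f := chartFlow I φ X (φ t X))
    (v := fun p => vecRep I (φ t X) (u p.1) p.2) he (contDiffWithinAt_chartFlow hJ hφ ht X)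
    (Eventually.of_forall fun z => chartFlow_mem_range _ _ _) ?_ ?_
  · rw [hbase] at h
    exact h
  · rw [hbase]
    exact (hu.contDiffWithinAt_vecRep hJ ht (φ t X)).differentiableWithinAt (by norm_num)
  · have h1 : Tendsto (fun z : 𝔼 => (t, (extChartAt I X).symm z)) (𝓝[range I] (extChartAt I X X))
        (𝓝 (t, X)) := by
      have h2 : ContinuousAt (extChartAt I X).symm (extChartAt I X X) :=
        continuousAt_extChartAt_symm X
      have h3 := h2.tendsto
      rw [extChartAt_to_inv] at h3
      rw [nhds_prod_eq]
      exact tendsto_const_nhds.prodMk (h3.mono_left nhdsWithin_le_nhds)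
    filter_upwards [h1.eventually (eventually_chartFlow_mem_source hJ hφ ht X)] with z hz
    exact hasDerivAt_chartFlow (hvel t ht _) hz.2

/-! ### Transport of one-forms and of circulations -/

variable (I) in
/-- The pullback of the time-dependent one-form `α` by `φ`, in the chart at `X`; the chart at `x`
is used on the target. -/
noncomputable def chartPullback (φ : ℝ → M → M) (α : ℝ → (y : M) → TangentSpace I y →L[ℝ] ℝ)
    (X x : M) (p : ℝ × EuclideanSpace ℝ (Fin n)) : EuclideanSpace ℝ (Fin n) →L[ℝ] ℝ :=
  (formRep I x (α p.1) (chartFlow I φ X x p)).comp (chartFlowDeriv I φ X x p)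

variable {α β : ℝ → (y : M) → TangentSpace I y →L[ℝ] ℝ}

theorem contDiffWithinAt_chartPullback (hJ : IsOpen J)
    (hφ : ContMDiffOn (𝓘(ℝ, ℝ).prod I) I 2 (fun p : ℝ × M => φ p.1 p.2) (J ×ˢ univ))
    {t : ℝ} (ht : t ∈ J) (X : M)
    (hα : ContDiffWithinAt ℝ 1 (fun p : ℝ × 𝔼 => formRep I (φ t X) (α p.1) p.2)
      (univ ×ˢ range I) (t, extChartAt I (φ t X) (φ t X))) :
    ContDiffWithinAt ℝ 1 (chartPullback I φ α X (φ t X)) (univ ×ˢ range I)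
      (t, extChartAt I X X) := by
  have hf := contDiffWithinAt_chartFlow hJ hφ ht X
  have hdf : ContDiffWithinAt ℝ 1 (chartFlowDeriv I φ X (φ t X)) (univ ×ˢ range I)
      (t, extChartAt I X X) :=
    hf.fderivWithin_slice I.uniqueDiffOn (mem_range_self _)
  have hbase := chartFlow_extChartAt (φ := φ) (I := I) X (φ t X) t (mem_extChartAt_source X)
  have h1 : ContDiffWithinAt ℝ 1 (fun p : ℝ × 𝔼 => (p.1, chartFlow I φ X (φ t X) p))
      (univ ×ˢ range I) (t, extChartAt I X X) :=
    contDiffWithinAt_fst.prodMk (hf.of_le (by norm_num))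
  rw [← hbase] at hα
  exact (ContDiffWithinAt.comp (t := univ ×ˢ range I) (t, extChartAt I X X) hα h1
    (fun p _ => ⟨mem_univ _, chartFlow_mem_range _ _ _⟩)).clm_comp hdf

/-- The Lie derivative formula `∂ₜ (φ_t^* α) = φ_t^* (∂ₜ α + £_u α)`, in charts at the base
point. -/
theorem hasDerivAt_chartPullback (hJ : IsOpen J) (hu : JointlyC1Vector J u)
    (hφ : ContMDiffOn (𝓘(ℝ, ℝ).prod I) I 2 (fun p : ℝ × M => φ p.1 p.2) (J ×ˢ univ))
    (hvel : ∀ t ∈ J, ∀ X : M, HasMFDerivAt 𝓘(ℝ, ℝ) I (fun σ => φ σ X) t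
      (ContinuousLinearMap.toSpanSingleton ℝ (u t (φ t X))))
    {t : ℝ} (ht : t ∈ J) (X : M)
    (hα : ContDiffWithinAt ℝ 1 (fun p : ℝ × 𝔼 => formRep I (φ t X) (α p.1) p.2)
      (univ ×ˢ range I) (t, extChartAt I (φ t X) (φ t X)))
    (hβ : ∀ v : TangentSpace I (φ t X), HasDerivAt (fun σ => α σ (φ t X) v)
      (β t (φ t X) v - lieForm (u t) (α t) (φ t X) v) t) (w : 𝔼) :
    HasDerivAt (fun σ => chartPullback I φ α X (φ t X) (σ, extChartAt I X X) w)
      (β t (φ t X) (chartFlowDeriv I φ X (φ t X) (t, extChartAt I X X) w)) t := by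
  set x := φ t X with hx
  have hXs := mem_extChartAt_source (I := I) X
  have hxs := mem_extChartAt_source (I := I) x
  have hy : HasDerivAt (fun σ => extChartAt I x (φ σ X)) (u t x) t := by
    have h := hasDerivAt_chartFlow (hvel t ht X) (x := x) hxs
    rw [vecRep, ← hx, chartDeriv_self, ContinuousLinearMap.inverse_id] at h
    refine h.congr_deriv ?_
    have : ∀ y', y' = x → (u t y' : 𝔼) = u t x := by rintro _ rfl; rfl
    exact this _ (extChartAt_to_inv x)
  have hP := hasDerivAt_chartFlowDeriv hJ hu hφ hvel ht X
  rw [← hx] at hP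
  have hαd := hα.differentiableWithinAt (n := 1) (by norm_num)
  have hrx : extChartAt I x x ∈ range I := mem_range_self _
  have hslice := hasDerivAt_slice (p := (t, extChartAt I x x)) hrx hαd
  set A : 𝔼 →L[ℝ] ℝ := fderivWithin ℝ (fun p : ℝ × 𝔼 => formRep I x (α p.1) p.2)
      (univ ×ˢ range I) (t, extChartAt I x x) (1, 0)
  have hA : ∀ v : 𝔼, A v = β t x v - lieForm (u t) (α t) x v := by
    intro v
    have h1 : HasDerivAt (fun σ => formRep I x (α σ) (extChartAt I x x) v) (A v) t := by
      simpa using hslice.clm_apply (hasDerivAt_const t v)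
    refine h1.unique ((hβ v).congr_of_eventuallyEq (Eventually.of_forall fun σ => ?_))
    exact formRep_self x (α σ) v
  have hμ := hasDerivAt_along_curve (R := range I) I.uniqueDiffOn
    (G := fun p : ℝ × 𝔼 => formRep I x (α p.1) p.2) (y := fun σ => extChartAt I x (φ σ X)) hy
    (Eventually.of_forall fun σ => mem_range_self _) hαd hslice
  have hfin := (hμ.clm_comp hP).clm_apply (hasDerivAt_const t w)
  have hflow : ∀ σ, chartFlow I φ X x (σ, extChartAt I X X) = extChartAt I x (φ σ X) :=
    fun σ => chartFlow_extChartAt X x σ hXs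
  simp only [chartPullback, hflow]
  refine hfin.congr_deriv ?_
  have hlie : ∀ v : 𝔼, lieForm (u t) (α t) x v =
      fderivWithin ℝ (formRep I x (α t)) (range I) (extChartAt I x x) (u t x) v +
        α t x (fderivWithin ℝ (vecRep I x (u t)) (range I) (extChartAt I x x) v) := fun v => rfl
  simp only [← hx, add_apply, ContinuousLinearMap.comp_apply, map_zero,
    add_zero]
  rw [hA, hlie, formRep_self]
  ring

/-- The circulation integrand, in charts. -/
theorem form_mfderiv_eq_chartPullback {X x : M} {σ s : ℝ} {γ : ℝ → M}
    (hγ : MDifferentiableAt 𝓘(ℝ, ℝ) I γ s) (hφ : MDifferentiableAt I I (φ σ) (γ s))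
    (hs : γ s ∈ (extChartAt I X).source) (hs' : φ σ (γ s) ∈ (extChartAt I x).source)
    (θ : ℝ → (y : M) → TangentSpace I y →L[ℝ] ℝ) :
    θ σ (φ σ (γ s)) (mfderiv 𝓘(ℝ, ℝ) I (fun s => φ σ (γ s)) s (1 : ℝ)) =
      chartPullback I φ θ X x (σ, extChartAt I X (γ s))
        (deriv (fun s => extChartAt I X (γ s)) s) := by
  have h1 : (mfderiv 𝓘(ℝ, ℝ) I (fun s => φ σ (γ s)) s (1 : ℝ) : 𝔼) =
      mfderiv I I (φ σ) (γ s) (mfderiv 𝓘(ℝ, ℝ) I γ s (1 : ℝ)) := by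
    have := mfderiv_comp s hφ hγ
    exact congrArg (fun L : ℝ →L[ℝ] 𝔼 => L 1) this
  have h2 := mfderiv_curve_eq hγ hs
  have h3 : (mfderiv 𝓘(ℝ, ℝ) I (fun s => φ σ (γ s)) s (1 : ℝ) : 𝔼) =
      chartDeriv I x (extChartAt I x (φ σ (γ s)))
        (chartFlowDeriv I φ X x (σ, extChartAt I X (γ s))
          (deriv (fun s => extChartAt I X (γ s)) s)) := by
    rw [h1, ← mfderiv_chartFlowDeriv hs hs' hφ]
    exact congrArg (mfderiv I I (φ σ) (γ s)) h2
  rw [chartPullback, chartFlow_extChartAt X x σ hs, ContinuousLinearMap.comp_apply,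
    formRep_extChartAt x (θ σ) hs']
  exact congrArg (θ σ (φ σ (γ s))) h3

/-- The transport theorem for circulations: if `∂ₜ α + £_u α = β` then the circulation of `α` along
a loop moving with the flow of `u` changes at the rate given by the circulation of `β`. -/
theorem hasDerivAt_loopIntegral_of_flow (hJ : IsOpen J) (hu : JointlyC1Vector J u)
    (hφ : ContMDiffOn (𝓘(ℝ, ℝ).prod I) I 2 (fun p : ℝ × M => φ p.1 p.2) (J ×ˢ univ))
    (hvel : ∀ t ∈ J, ∀ X : M, HasMFDerivAt 𝓘(ℝ, ℝ) I (fun σ => φ σ X) t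
      (ContinuousLinearMap.toSpanSingleton ℝ (u t (φ t X))))
    (hα : ∀ t ∈ J, ∀ x, ContDiffWithinAt ℝ 1 (fun p : ℝ × 𝔼 => formRep I x (α p.1) p.2)
      (univ ×ˢ range I) (t, extChartAt I x x))
    (hβ : ∀ t ∈ J, ∀ x, ∀ v : TangentSpace I x, HasDerivAt (fun σ => α σ x v)
      (β t x v - lieForm (u t) (α t) x v) t) {γ : ℝ → M} (hγ : ContMDiff 𝓘(ℝ, ℝ) I 1 γ) {t : ℝ}
    (ht : t ∈ J) :
    HasDerivAt (fun σ => loopIntegral (α σ) (fun s => φ σ (γ s)))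
      (loopIntegral (β t) (fun s => φ t (γ s))) t := by
  let g : ℝ × ℝ → ℝ := fun q =>
    α q.1 (φ q.1 (γ q.2)) (mfderiv 𝓘(ℝ, ℝ) I (fun s => φ q.1 (γ s)) q.2 (1 : ℝ))
  let g' : ℝ × ℝ → ℝ := fun q =>
    β q.1 (φ q.1 (γ q.2)) (mfderiv 𝓘(ℝ, ℝ) I (fun s => φ q.1 (γ s)) q.2 (1 : ℝ))
  have hγd : ∀ s, MDifferentiableAt 𝓘(ℝ, ℝ) I γ s := fun s => hγ.mdifferentiableAt one_ne_zero
  have hφd : ∀ σ ∈ J, ∀ X, MDifferentiableAt I I (φ σ) X := fun σ hσ X =>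
    (contMDiff_of_jointly hφ hσ).mdifferentiableAt two_ne_zero
  have hloc : ∀ σ ∈ J, ∀ s, ∀ᶠ q : ℝ × ℝ in 𝓝 (σ, s), q.1 ∈ J ∧
      γ q.2 ∈ (extChartAt I (γ s)).source ∧
      φ q.1 (γ q.2) ∈ (extChartAt I (φ σ (γ s))).source := by
    intro σ hσ s
    have h1 : Tendsto (fun q : ℝ × ℝ => (q.1, γ q.2)) (𝓝 (σ, s)) (𝓝 (σ, γ s)) :=
      (continuous_fst.prodMk (hγ.continuous.comp continuous_snd)).tendsto' _ _ rfl
    exact (continuousAt_fst.eventually (hJ.mem_nhds hσ)).and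
      (h1.eventually (eventually_chartFlow_mem_source hJ hφ hσ (γ s)))
  have hg : ∀ σ ∈ J, ∀ s, ∀ᶠ q in 𝓝 (σ, s), g q =
      chartPullback I φ α (γ s) (φ σ (γ s)) (q.1, extChartAt I (γ s) (γ q.2))
        (deriv (fun s' => extChartAt I (γ s) (γ s')) q.2) := by
    intro σ hσ s
    filter_upwards [hloc σ hσ s] with q hq
    exact form_mfderiv_eq_chartPullback (hγd _) (hφd _ hq.1 _) hq.2.1 hq.2.2 α
  have hd : ∀ σ ∈ J, ∀ s, HasDerivAt (fun σ' => g (σ', s)) (g' (σ, s)) σ := by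
    intro σ hσ s
    have h1 := hasDerivAt_chartPullback hJ hu hφ hvel hσ (γ s) (hα σ hσ _) (hβ σ hσ _)
      (deriv (fun s' => extChartAt I (γ s) (γ s')) s)
    have h4 : Tendsto (fun σ' : ℝ => (σ', s)) (𝓝 σ) (𝓝 (σ, s)) :=
      (continuous_id.prodMk continuous_const).tendsto' _ _ rfl
    refine (h1.congr_of_eventuallyEq (h4.eventually (hg σ hσ s))).congr_deriv ?_
    have h5 := form_mfderiv_eq_chartPullback (x := φ σ (γ s)) (hγd s) (hφd _ hσ (γ s))
      (mem_extChartAt_source (I := I) (γ s)) (mem_extChartAt_source (I := I) _) β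
    refine Eq.trans ?_ h5.symm
    rw [chartPullback, chartFlow_extChartAt _ _ _ (mem_extChartAt_source _),
      ContinuousLinearMap.comp_apply, formRep_self]
  have hcont : ∀ σ ∈ J, ∀ s, ContinuousAt g (σ, s) ∧ ContinuousAt g' (σ, s) := by
    intro σ hσ s
    have hc : ContDiffAt ℝ 1 (fun s' => extChartAt I (γ s) (γ s')) s := by
      have := isManifold_one_of_infty (I := I) (M := M)
      exact contMDiffAt_iff_contDiffAt.1
        (ContMDiffAt.comp s (g := extChartAt I (γ s)) contMDiffAt_extChartAt hγ.contMDiffAt)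
    refine continuousAt_form_along_curve (R := range I) I.uniqueDiffOn
      (fun s' => mem_range_self _) hc
      (contDiffWithinAt_chartPullback hJ hφ hσ (γ s) (hα σ hσ _)) (hg σ hσ s) ?_
    filter_upwards [continuousAt_fst.eventually (hJ.mem_nhds hσ)] with q hq
    exact hd q.1 hq q.2
  exact hasDerivAt_intervalIntegral_of_continuousAt (g := fun σ s => g (σ, s))
    (g' := fun σ s => g' (σ, s)) hJ ht
    (fun σ hσ => continuous_iff_continuousAt.2 fun s =>
      (hcont σ hσ s).1.comp (f := fun s' => (σ, s')) (continuousAt_const.prodMk continuousAt_id))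
    hd (fun s => (hcont t ht s).2)

/-! ### Densities and the continuity equation -/

variable {D : ℝ → M → ℝ}

/-- Joint `C¹` regularity of a time-dependent function, in charts. -/
theorem contDiffWithinAt_scalarRep (hJ : IsOpen J)
    (hD : ContMDiffOn (𝓘(ℝ, ℝ).prod I) 𝓘(ℝ, ℝ) 1 (fun p : ℝ × M => D p.1 p.2) (J ×ˢ univ)) {t : ℝ}
    (ht : t ∈ J) (x : M) :
    ContDiffWithinAt ℝ 1 (fun p : ℝ × 𝔼 => D p.1 ((extChartAt I x).symm p.2)) (univ ×ˢ range I)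
      (t, extChartAt I x x) :=
  ((hD (t, x) ⟨ht, mem_univ _⟩).contMDiffAt
    (prod_mem_nhds (hJ.mem_nhds ht) univ_mem)).comp_extChartAt_symm (by simp)

omit [IsManifold I ∞ M] in
theorem mfderiv_scalar_eq {f : M → ℝ} {x : M} (hf : MDifferentiableAt I 𝓘(ℝ, ℝ) f x)
    (v : TangentSpace I x) :
    (mfderiv I 𝓘(ℝ, ℝ) f x v : ℝ) =
      fderivWithin ℝ (fun e => f ((extChartAt I x).symm e)) (range I) (extChartAt I x x) v := by
  rw [hf.mfderiv]
  rfl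

omit [IsManifold I ∞ M] in
theorem mdifferentiableAt_scalar
    (hD : ContMDiffOn (𝓘(ℝ, ℝ).prod I) 𝓘(ℝ, ℝ) 1 (fun p : ℝ × M => D p.1 p.2) (J ×ˢ univ)) {t : ℝ}
    (ht : t ∈ J) (x : M) : MDifferentiableAt I 𝓘(ℝ, ℝ) (D t) x := by
  have h1 : ContMDiffWithinAt I (𝓘(ℝ, ℝ).prod I) 1 (fun Y : M => (t, Y)) univ x :=
    (contMDiff_const.prodMk contMDiff_id).contMDiffAt
  exact (((hD (t, x) ⟨ht, mem_univ _⟩).comp x h1 (fun Y _ => ⟨ht, mem_univ _⟩)).contMDiffAt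
    univ_mem).mdifferentiableAt one_ne_zero

omit [IsManifold I ∞ M] in
/-- The Lie derivative of a density, with the derivative of `D` along `w` computed in the chart. -/
theorem lieDensity_eq [MeasurableSpace M] (dV : VolumeDensity I M)
    (hD : ContMDiffOn (𝓘(ℝ, ℝ).prod I) 𝓘(ℝ, ℝ) 1 (fun p : ℝ × M => D p.1 p.2) (J ×ˢ univ)) {t : ℝ}
    (ht : t ∈ J) (w : (y : M) → TangentSpace I y) (x : M) :
    lieDensity dV w (D t) x =
      fderivWithin ℝ (fun e => D t ((extChartAt I x).symm e)) (range I) (extChartAt I x x) (w x) +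
        D t x * divergence dV w x := by
  rw [lieDensity, ← mfderiv_scalar_eq (mdifferentiableAt_scalar hD ht x)]

/-- The differential of a diffeomorphism in charts is invertible. -/
theorem chartFlowDeriv_isInvertible (η : ℝ → M ≃ₘ^2⟮I, I⟯ M) (t : ℝ) (X : M) :
    (chartFlowDeriv I (fun t x => η t x) X (η t X) (t, extChartAt I X X)).IsInvertible := by
  refine ⟨(η t).mfderivToContinuousLinearEquiv two_ne_zero X, ?_⟩
  refine (Diffeomorph.mfderivToContinuousLinearEquiv_coe (η t) two_ne_zero).trans ?_
  refine ContinuousLinearMap.ext fun w => ?_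
  have h := mfderiv_chartFlowDeriv (φ := fun t x => η t x) (σ := t)
    (mem_extChartAt_source (I := I) X)
    (mem_extChartAt_source (I := I) (η t X)) ((η t).mdifferentiable two_ne_zero X) w
  rw [chartDeriv_self, chartDeriv_self] at h
  exact h

/-- The determinant of `mfderiv`, which is taken in the moving preferred charts, in terms of the
differential in the fixed charts at `X` and `x`. -/
theorem det_mfderiv_eq {X x : M} {σ : ℝ} (hx : φ σ X ∈ (extChartAt I x).source)
    (hφ : MDifferentiableAt I I (φ σ) X) :
    ContinuousLinearMap.det (show 𝔼 →L[ℝ] 𝔼 from mfderiv I I (φ σ) X) =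
      (chartDeriv I x (extChartAt I x (φ σ X))).det *
        (chartFlowDeriv I φ X x (σ, extChartAt I X X)).det := by
  have h : (show 𝔼 →L[ℝ] 𝔼 from mfderiv I I (φ σ) X) =
      (chartDeriv I x (extChartAt I x (φ σ X))).comp
        (chartFlowDeriv I φ X x (σ, extChartAt I X X)) := by
    ext1 w
    have h := mfderiv_chartFlowDeriv (mem_extChartAt_source (I := I) X) hx hφ w
    rw [chartDeriv_self] at h
    exact h
  rw [h]
  exact LinearMap.det_comp _ _

omit [IsManifold I ∞ M] in
theorem VolumeDensity.differentiableWithinAt_densRep [MeasurableSpace M] (dV : VolumeDensity I M)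
    (x : M) :
    DifferentiableWithinAt ℝ (densRep I x dV.coeff) (range I) (extChartAt I x x) :=
  ((dV.smooth x _ (mem_extChartAt_target x)).differentiableWithinAt
    (by simp)).mono_of_mem_nhdsWithin
    (extChartAt_target_mem_nhdsWithin x)

theorem densRep_self (x : M) (ρ : M → ℝ) : densRep I x ρ (extChartAt I x x) = ρ x := by
  rw [densRep_extChartAt x ρ (mem_extChartAt_source x), chartDeriv_self]
  simp [ContinuousLinearMap.det]

/-- A density carried along by the flow satisfies the continuity equation: the time derivative of
the constant density `η_t^* (D_t dV)` is the pullback of the left-hand side of the continuity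
equation. -/
theorem PushForwardRelation.continuityEquation [MeasurableSpace M] (hJ : IsOpen J)
    (dV : VolumeDensity I M) {η : ℝ → M ≃ₘ^2⟮I, I⟯ M} (hu : JointlyC1Vector J u)
    (hη : IsFlowOf J η u)
    (hD : ContMDiffOn (𝓘(ℝ, ℝ).prod I) 𝓘(ℝ, ℝ) 1 (fun p : ℝ × M => D p.1 p.2) (J ×ˢ univ))
    {D₀ : M → ℝ} (h : PushForwardRelation J dV η D D₀) : ContinuityEquation J dV u D := by
  intro t ht x
  obtain ⟨X, rfl⟩ := (η t).surjective x
  set φ : ℝ → M → M := fun t x => η t x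
  have hφ := hη.1
  change HasDerivAt (fun σ => D σ (φ t X)) (-lieDensity dV (u t) (D t) (φ t X)) t
  set x := φ t X
  have hxs := mem_extChartAt_source (I := I) x
  have hrx : extChartAt I x x ∈ range I := mem_range_self _
  have hyR : ∀ᶠ σ in 𝓝 t, extChartAt I x (φ σ X) ∈ range I :=
    Eventually.of_forall fun σ => mem_range_self _
  have hy : HasDerivAt (fun σ => extChartAt I x (φ σ X)) (u t x) t := by
    have h := hasDerivAt_chartFlow (φ := φ) (hη.2 t ht X) (x := x) hxs
    rw [vecRep_extChartAt x (u t) hxs] at h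
    have := isManifold_one_of_infty (I := I) (M := M)
    exact h.congr_deriv (congrArg (fun L : 𝔼 →L[ℝ] 𝔼 => L (u t x)) mfderiv_extChartAt_self)
  -- the derivatives of the three factors
  have hDd := (contDiffWithinAt_scalarRep hJ hD ht x).differentiableWithinAt (n := 1) (by norm_num)
  set a : ℝ := fderivWithin ℝ (fun p : ℝ × 𝔼 => D p.1 ((extChartAt I x).symm p.2))
    (univ ×ˢ range I) (t, extChartAt I x x) (1, 0)
  set b : ℝ := fderivWithin ℝ (fun e => D t ((extChartAt I x).symm e)) (range I)
    (extChartAt I x x) (u t x) with hb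
  have hDt : HasDerivAt (fun σ => D σ ((extChartAt I x).symm (extChartAt I x x))) a t :=
    hasDerivAt_slice (p := (t, extChartAt I x x)) hrx hDd
  have h1 : HasDerivAt (fun σ => D σ ((extChartAt I x).symm (extChartAt I x (φ σ X)))) (a + b) t :=
    hasDerivAt_along_curve (R := range I) I.uniqueDiffOn
      (G := fun p : ℝ × 𝔼 => D p.1 ((extChartAt I x).symm p.2)) hy hyR hDd hDt
  have h2 : HasDerivAt (fun σ => densRep I x dV.coeff (extChartAt I x (φ σ X)))
      (fderivWithin ℝ (densRep I x dV.coeff) (range I) (extChartAt I x x) (u t x)) t :=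
    hasDerivWithinAt_univ.1 <| HasFDerivWithinAt.comp_hasDerivWithinAt
      (f := fun σ => extChartAt I x (φ σ X)) (t := range I)
      t (dV.differentiableWithinAt_densRep x).hasFDerivWithinAt hy.hasDerivWithinAt
      (fun σ _ => mem_range_self _)
  have hinv := chartFlowDeriv_isInvertible η t X
  have h3' := (hasDerivAt_chartFlowDeriv (φ := φ) hJ hu hφ hη.2 ht X).clm_det hinv
  have hdet : (chartFlowDeriv I φ X x (t, extChartAt I X X)).det ≠ 0 := by
    obtain ⟨e, he⟩ := hinv
    rw [← he]
    exact (LinearEquiv.isUnit_det' e.toLinearEquiv).ne_zero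
  have h3 : HasDerivAt (fun σ => |(chartFlowDeriv I φ X x (σ, extChartAt I X X)).det|)
      (LinearMap.trace ℝ 𝔼
        (fderivWithin ℝ (vecRep I x (u t)) (range I) (extChartAt I x x)).toLinearMap *
          |(chartFlowDeriv I φ X x (t, extChartAt I X X)).det|) t := by
    refine (HasDerivAt.comp t (hasDerivAt_abs hdet) h3').congr_deriv ?_
    rw [mul_left_comm, sign_mul_self]
  -- the product is constant
  have hconst : ∀ᶠ σ in 𝓝 t, D σ ((extChartAt I x).symm (extChartAt I x (φ σ X))) *
      densRep I x dV.coeff (extChartAt I x (φ σ X)) *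
      |(chartFlowDeriv I φ X x (σ, extChartAt I X X)).det| = D₀ X * dV.coeff X := by
    have h4 : Tendsto (fun σ : ℝ => (σ, X)) (𝓝 t) (𝓝 (t, X)) :=
      (continuous_id.prodMk continuous_const).tendsto' _ _ rfl
    filter_upwards [h4.eventually (eventually_chartFlow_mem_source (φ := φ) hJ hφ ht X),
      hJ.mem_nhds ht] with σ hσ hσJ
    have h5 := h σ hσJ X
    have h6 := det_mfderiv_eq (φ := φ) hσ.2 ((η σ).mdifferentiable two_ne_zero X)
    rw [jacobian] at h5
    rw [densRep_extChartAt x _ hσ.2, (extChartAt I x).left_inv hσ.2, ← h5]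
    have h7 : ContinuousLinearMap.det (show 𝔼 →L[ℝ] 𝔼 from mfderiv I I (η σ) X) = _ := h6
    rw [h7, abs_mul]
    have := (dV.coeff_pos X).ne'
    change _ = D σ (φ σ X) * (dV.coeff (φ σ X) *
      (|(chartDeriv I x (extChartAt I x (φ σ X))).det| *
        |(chartFlowDeriv I φ X x (σ, extChartAt I X X)).det|) / dV.coeff X) * dV.coeff X
    field_simp
  have hprod := ((h1.mul h2).mul h3).unique
    ((hasDerivAt_const t (D₀ X * dV.coeff X)).congr_of_eventuallyEq hconst)
  have hzero : ((a + b) * densRep I x dV.coeff (extChartAt I x x) +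
      D t ((extChartAt I x).symm (extChartAt I x x)) *
        fderivWithin ℝ (densRep I x dV.coeff) (range I) (extChartAt I x x) (u t x)) *
        |(chartFlowDeriv I φ X x (t, extChartAt I X X)).det| +
      D t ((extChartAt I x).symm (extChartAt I x x)) * densRep I x dV.coeff (extChartAt I x x) *
        (LinearMap.trace ℝ 𝔼
          (fderivWithin ℝ (vecRep I x (u t)) (range I) (extChartAt I x x)).toLinearMap *
          |(chartFlowDeriv I φ X x (t, extChartAt I X X)).det|) = 0 := hprod
  have hρ := (dV.coeff_pos x).ne'
  rw [densRep_self, extChartAt_to_inv] at hzero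
  rw [extChartAt_to_inv] at hDt
  refine hDt.congr_deriv ?_
  rw [lieDensity_eq dV hD ht, ← hb, divergence]
  have habs := abs_ne_zero.2 hdet
  have hzero' : (a + b) * dV.coeff x +
      D t x * fderivWithin ℝ (densRep I x dV.coeff) (range I) (extChartAt I x x) (u t x) +
      D t x * dV.coeff x * LinearMap.trace ℝ 𝔼
          (fderivWithin ℝ (vecRep I x (u t)) (range I) (extChartAt I x x)).toLinearMap = 0 :=
    mul_right_cancel₀ habs (by linear_combination hzero)
  field_simp
  linear_combination hzero'

/-- Dividing by a density that satisfies the continuity equation removes the divergence term. -/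
theorem ContinuityEquation.hasDerivAt_divDensity [MeasurableSpace M] (hJ : IsOpen J)
    (dV : VolumeDensity I M) {m F : ℝ → (y : M) → TangentSpace I y →L[ℝ] ℝ}
    (hm : JointlyC1Form J m) (hEP : EulerPoincareEquation J dV u m F)
    (hD : ContMDiffOn (𝓘(ℝ, ℝ).prod I) 𝓘(ℝ, ℝ) 1 (fun p : ℝ × M => D p.1 p.2) (J ×ˢ univ))
    (hD' : ∀ t ∈ J, ∀ x, D t x ≠ 0) (h : ContinuityEquation J dV u D) {t : ℝ} (ht : t ∈ J) (x : M)
    (v : TangentSpace I x) :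
    HasDerivAt (fun σ => divDensity (D σ) (m σ) x v)
      (divDensity (D t) (F t) x v - lieForm (u t) (divDensity (D t) (m t)) x v) t := by
  have hrx : extChartAt I x x ∈ range I := mem_range_self _
  have hslice : ∀ {G : Type} [NormedAddCommGroup G] [NormedSpace ℝ G] {f : ℝ × 𝔼 → G},
      ContDiffWithinAt ℝ 1 f (univ ×ˢ range I) (t, extChartAt I x x) →
      DifferentiableWithinAt ℝ (fun e => f (t, e)) (range I) (extChartAt I x x) :=
    fun hf => ((hf.differentiableWithinAt (by norm_num)).hasFDerivWithinAt.comp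
      (t := univ ×ˢ range I) _ (hasFDerivAt_prodMk_right t _).hasFDerivWithinAt
      (fun z hz => ⟨mem_univ _, hz⟩)).differentiableWithinAt
  have hDs : DifferentiableWithinAt ℝ (fun e => D t ((extChartAt I x).symm e)) (range I)
      (extChartAt I x x) := hslice (contDiffWithinAt_scalarRep hJ hD ht x)
  have hms : DifferentiableWithinAt ℝ (formRep I x (m t)) (range I) (extChartAt I x x) :=
    hslice (hm.contDiffWithinAt_formRep hJ ht x)
  have hDx : D t ((extChartAt I x).symm (extChartAt I x x)) ≠ 0 := hD' t ht _
  have hrep : fderivWithin ℝ (formRep I x (divDensity (D t) (m t))) (range I) (extChartAt I x x)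
      = _ :=
    ((HasDerivAt.comp_hasFDerivWithinAt (f := fun e => D t ((extChartAt I x).symm e))
      (extChartAt I x x) (hasDerivAt_inv hDx) hDs.hasFDerivWithinAt).smul
      hms.hasFDerivWithinAt).fderivWithin (I.uniqueDiffOn _ hrx)
  have hlie : ∀ (w : (y : M) → TangentSpace I y) (θ : (y : M) → TangentSpace I y →L[ℝ] ℝ),
      lieForm w θ x v = fderivWithin ℝ (formRep I x θ) (range I) (extChartAt I x x) (w x) v +
        θ x (fderivWithin ℝ (vecRep I x w) (range I) (extChartAt I x x) v) := fun _ _ => rfl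
  have hL : lieForm (u t) (divDensity (D t) (m t)) x v =
      (D t x)⁻¹ * lieForm (u t) (m t) x v - ((D t x) ^ 2)⁻¹ *
        fderivWithin ℝ (fun e => D t ((extChartAt I x).symm e)) (range I) (extChartAt I x x)
          (u t x) * m t x v := by
    rw [hlie, hlie, hrep]
    change (D t ((extChartAt I x).symm (extChartAt I x x)))⁻¹ *
        fderivWithin ℝ (formRep I x (m t)) (range I) (extChartAt I x x) (u t x) v +
      (-(D t ((extChartAt I x).symm (extChartAt I x x)) ^ 2)⁻¹ *
        fderivWithin ℝ (fun e => D t ((extChartAt I x).symm e)) (range I) (extChartAt I x x)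
          (u t x)) * formRep I x (m t) (extChartAt I x x) v +
      (D t x)⁻¹ * m t x (fderivWithin ℝ (vecRep I x (u t)) (range I) (extChartAt I x x) v) = _
    have hmx : formRep I x (m t) (extChartAt I x x) v = m t x v := formRep_self x (m t) v
    rw [extChartAt_to_inv, hmx]
    ring
  have hLd : lieFormDensity dV (u t) (m t) x v =
      lieForm (u t) (m t) x v + divergence dV (u t) x * m t x v := rfl
  refine (((h t ht x).inv (hD' t ht x)).mul (hEP t ht x v)).congr_deriv ?_
  change _ = (D t x)⁻¹ * F t x v - _
  rw [hL, hLd, lieDensity_eq dV hD ht, Pi.inv_apply]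
  have := hD' t ht x
  field_simp
  ring

theorem contDiffWithinAt_formRep_divDensity (hJ : IsOpen J)
    {m : ℝ → (y : M) → TangentSpace I y →L[ℝ] ℝ} (hm : JointlyC1Form J m)
    (hD : ContMDiffOn (𝓘(ℝ, ℝ).prod I) 𝓘(ℝ, ℝ) 1 (fun p : ℝ × M => D p.1 p.2) (J ×ˢ univ))
    (hD' : ∀ t ∈ J, ∀ x, D t x ≠ 0) {t : ℝ} (ht : t ∈ J) (x : M) :
    ContDiffWithinAt ℝ 1 (fun p : ℝ × 𝔼 => formRep I x (divDensity (D p.1) (m p.1)) p.2)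
      (univ ×ˢ range I) (t, extChartAt I x x) :=
  ((contDiffWithinAt_scalarRep hJ hD ht x).inv (hD' t ht _)).smul
    (hm.contDiffWithinAt_formRep hJ ht x)

end Manifold

end KelvinNoether

theorem mainTheorem3 {n : ℕ} {H : Type*} [TopologicalSpace H]
    (I : ModelWithCorners ℝ (EuclideanSpace ℝ (Fin n)) H)
    {M : Type*} [TopologicalSpace M] [ChartedSpace H M] [IsManifold I ∞ M]
    [T2Space M] [SecondCountableTopology M] [MeasurableSpace M] [BorelSpace M]
    (dV : VolumeDensity I M)
    {ι : Type*} [Fintype ι] (τ : ι → TensorType)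
    -- the spaces of velocities and of advected quantities, and the Lagrangian
    (𝔤 : Submodule ℝ (VectorFields I M)) (h𝔤 : ContainsTestFields 𝔤)
    (Vstar : Submodule ℝ (TensorFields n M τ)) (hVstar : ∀ a ∈ Vstar, IsC1Tensor I a)
    (ℓ : 𝔤 → Vstar → ℝ)
    -- the motion
    (J : Set ℝ) (hJ : IsOpen J) (hJ' : J.OrdConnected)
    (η : ℝ → M ≃ₘ^2⟮I, I⟯ M) (u : ℝ → 𝔤)
    (hu : JointlyC1Vector J (fun t x => (u t).1 x))
    (hη : IsFlowOf J η (fun t x => (u t).1 x))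
    -- the advected quantities
    (a : ℝ → Vstar) (ha : AdvectionRelation J dV (fun t x => (u t).1 x) (fun t => (a t).1))
    -- `m = δℓ/δu`, `b = δℓ/δa`, `F = δℓ/δa ⋄ a`, and the Euler-Poincaré equation
    (m : ℝ → (y : M) → TangentSpace I y →L[ℝ] ℝ) (hm' : JointlyC1Form J m)
    (hm : ∀ t ∈ J, IsVelocityDerivative dV ℓ (u t) (a t) (m t))
    (b : ℝ → DualFields n M τ) (hb : ∀ t ∈ J, IsTensorDerivative dV ℓ (u t) (a t) (b t))
    (F : ℝ → (y : M) → TangentSpace I y →L[ℝ] ℝ)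
    (hF : ∀ t ∈ J, IsDiamond dV 𝔤 (b t) (a t).1 (F t))
    (hEP : EulerPoincareEquation J dV (fun t x => (u t).1 x) m F)
    -- the mass density
    (D : ℝ → M → ℝ)
    (hD : ContMDiffOn (𝓘(ℝ, ℝ).prod I) 𝓘(ℝ, ℝ) 1 (fun p : ℝ × M => D p.1 p.2) (J ×ˢ Set.univ))
    (hD' : ∀ t ∈ J, ∀ x, D t x ≠ 0) :
    (∀ D₀ : M → ℝ, PushForwardRelation J dV η D D₀ →
      ContinuityEquation J dV (fun t x => (u t).1 x) D) ∧
    (ContinuityEquation J dV (fun t x => (u t).1 x) D →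
      ∀ γ₀ : ℝ → M, IsLoop I γ₀ → ∀ t ∈ J,
        HasDerivAt (fun σ => loopIntegral (divDensity (D σ) (m σ)) (fun s => η σ (γ₀ s)))
          (loopIntegral (divDensity (D t) (F t)) (fun s => η t (γ₀ s))) t) := by
  constructor
  · intro D₀ h
    exact h.continuityEquation hJ dV hu hη hD
  · intro hcont γ₀ hγ₀ t ht
    exact hasDerivAt_loopIntegral_of_flow hJ hu hη.1 hη.2
      (fun t ht x => contDiffWithinAt_formRep_divDensity hJ hm' hD hD' ht x)
      (fun t ht x v => hcont.hasDerivAt_divDensity hJ dV hm' hEP hD hD' ht x v) hγ₀.1 ht
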